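/- Let $A:[0,1]\to\mathbb{R}^{n\times n}$ and $B:[0,1]\to\mathbb{R}^{n\times m}$ be continuous, let $\rho_0,\rho_1$ be probability densities on $\mathbb{R}^n$ with respect to Lebesgue measure, $d\mu_i(x)=\rho_i(x)\,dx$ $(i=0,1)$, and let $\mathbf{x}_0$ be a random vector with law $\mu_0$ on a probability space $(\Omega,\mathcal{F},\mathbb{P})$. A *feedback law* is a continuous map $u:[0,1]\times\mathbb{R}^n\to\mathbb{R}^m$ such that for every $R$ there is a constant $K$ for which all the maps $u(t,\cdot)$, $t\in[0,1]$, are $K$-Lipschitz on the ball $\{\|x\|\le R\}$. Let $\mathcal{U}$ be the set of feedback laws $u$ for which there is a process $\mathbf{x}^u(t)$, $0\le t\le 1$ (it is then almost surely unique), such that almost surely $$\dot{\mathbf{x}}^u(t)=A(t)\mathbf{x}^u(t)+B(t)u(t,\mathbf{x}^u(t))\quad(0\le t\le 1),\qquad \mathbf{x}^u(0)=\mathbf{x}_0,$$ and $\mathbf{x}^u(1)\sim\mu_1$. Let $\mathcal{W}$ be the set of pairs $(\rho,u)$, where $u$ is a feedback law and $\rho:[0,1]\times\mathbb{R}^n\to[0,\infty)$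 is Borel with $\rho(t,\cdot)$ a probability density for every $t$, satisfying $$\frac{\partial\rho}{\partial t}(t,x)+\nabla_x\cdot\big[\rho(t,x)\big(A(t)x+B(t)u(t,x)\big)\big]=0,\qquad \rho(0,x)=\rho_0(x),\quad \rho(1,x)=\rho_1(x),$$ where the continuity equation is understood in the weak sense: for every $\varphi\in C_c^\infty(\mathbb{R}\times\mathbb{R}^n)$ and every $t\in[0,1]$, $$\int_{\mathbb{R}^n}\varphi(t,x)\rho(t,x)\,dx-\int_{\mathbb{R}^n}\varphi(0,x)\rho(0,x)\,dx=\int_0^t\!\int_{\mathbb{R}^n}\rho(s,x)\Big(\partial_s\varphi(s,x)+\big\langle\nabla_x\varphi(s,x),A(s)x+B(s)u(s,x)\big\rangle\Big)dx\,ds .$$ Then $$\inf_{u\in\mathcal{U}}\mathbb{E}\left\{\int_0^1\tfrac12\|u(t,\mathbf{x}^u(t))\|^2\,dt\right\}=\inf_{(\rho,u)\in\mathcal{W}}\int_{\mathbb{R}^n}\int_0^1\tfrac12\|u(t,x)\|^2\rho(t,x)\,dt\,dx ,$$ as an equality in $[0,\infty]$, with the infimum of the empty set equal to $+\infty$. 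-/

import Mathlib

open MeasureTheory ProbabilityTheory Set
open scoped NNReal ENNReal Matrix

noncomputable section

namespace LinearControl

/-- `ℝⁿ` with the Euclidean norm and Lebesgue measure. -/
abbrev Vec (n : ℕ) : Type := EuclideanSpace ℝ (Fin n)

/-- A (Borel) probability density on `ℝⁿ` with respect to Lebesgue measure. -/
structure IsProbDensity {n : ℕ} (ρ : Vec n → ℝ) : Prop where
  measurable : Measurable ρ
  nonneg : ∀ x, 0 ≤ ρ x
  lintegral_eq_one : ∫⁻ x, ENNReal.ofReal (ρ x) = 1

/-- The measure `ρ(x) dx` on `ℝⁿ`. -/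
def densityMeasure {n : ℕ} (ρ : Vec n → ℝ) : Measure (Vec n) :=
  volume.withDensity fun x => ENNReal.ofReal (ρ x)

/-- The closed-loop velocity field `V_u(t, x) = A(t) x + B(t) u(t, x)`. -/
def velocity {n m : ℕ} (A : ℝ → Matrix (Fin n) (Fin n) ℝ) (B : ℝ → Matrix (Fin n) (Fin m) ℝ)
    (u : ℝ → Vec n → Vec m) (t : ℝ) (x : Vec n) : Vec n :=
  WithLp.toLp 2 (A t *ᵥ x.ofLp + B t *ᵥ (u t x).ofLp)

/-- Feedback laws on `[0, 1] × ℝⁿ`: continuous, and locally Lipschitz in the state uniformly in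
time, so that closed-loop trajectories are unique.  Values at times outside `[0, 1]` are never
used. -/
structure IsFeedbackLaw {n m : ℕ} (u : ℝ → Vec n → Vec m) : Prop where
  continuousOn : ContinuousOn (fun p : ℝ × Vec n => u p.1 p.2) (Icc (0 : ℝ) 1 ×ˢ univ)
  locallyLipschitz : ∀ R : ℝ, ∃ K : ℝ≥0, ∀ t ∈ Icc (0 : ℝ) 1,
    LipschitzOnWith K (u t) (Metric.closedBall 0 R)

/-- `u` is an admissible feedback law for the stochastic control problem with initial state `x₀`
and final law `μ₁`, and `x` is its closed-loop state process: almost surely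
`ẋ(t) = A(t) x(t) + B(t) u(t, x(t))` for `0 ≤ t ≤ 1` (one-sided derivatives at `0` and `1`) and
`x(0) = x₀`; moreover `x(1) ∼ μ₁`. -/
structure IsControlled {n m : ℕ} (A : ℝ → Matrix (Fin n) (Fin n) ℝ)
    (B : ℝ → Matrix (Fin n) (Fin m) ℝ) {Ω : Type*} [MeasurableSpace Ω] (P : Measure Ω)
    (x₀ : Ω → Vec n) (μ₁ : Measure (Vec n)) (u : ℝ → Vec n → Vec m) (x : ℝ → Ω → Vec n) :
    Prop where
  feedback : IsFeedbackLaw u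
  measurable : ∀ t ∈ Icc (0 : ℝ) 1, Measurable (x t)
  initial : ∀ᵐ ω ∂P, x 0 ω = x₀ ω
  dynamics : ∀ᵐ ω ∂P, ∀ t ∈ Icc (0 : ℝ) 1,
    HasDerivWithinAt (fun s => x s ω) (velocity A B u t (x t ω)) (Icc 0 1) t
  final : HasLaw (x 1) μ₁ P

/-- The optimal value, in `[0, ∞]`, of the stochastic control problem:
the infimum of `𝔼 ∫₀¹ ½ ‖u(t, x(t))‖² dt`. -/
def stochasticControlValue {n m : ℕ} (A : ℝ → Matrix (Fin n) (Fin n) ℝ)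
    (B : ℝ → Matrix (Fin n) (Fin m) ℝ) {Ω : Type*} [MeasurableSpace Ω] (P : Measure Ω)
    (x₀ : Ω → Vec n) (μ₁ : Measure (Vec n)) : ℝ≥0∞ :=
  ⨅ (u : ℝ → Vec n → Vec m) (x : ℝ → Ω → Vec n) (_ : IsControlled A B P x₀ μ₁ u x),
    ∫⁻ ω, (∫⁻ t in Icc (0 : ℝ) 1, ENNReal.ofReal (1 / 2 * ‖u t (x t ω)‖ ^ 2)) ∂P

/-- `∂ₜρ + ∇ₓ · (ρ V) = 0` on `[0, 1] × ℝⁿ` in the weak sense: for every smooth compactly supported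
`φ(t, x)` and every `t ∈ [0, 1]`,
`∫ φ(t,·) ρ(t,·) dx - ∫ φ(0,·) ρ(0,·) dx = ∫₀ᵗ ∫ ρ (∂ₛφ + ⟨∇ₓφ, V⟩) dx ds`.
The derivative of `φ` at `(s, x)` in the direction `(1, V(s, x))` is `∂ₛφ + ⟨∇ₓφ, V⟩`. -/
def IsWeakContinuitySolution {n : ℕ} (ρ : ℝ → Vec n → ℝ) (V : ℝ → Vec n → Vec n) : Prop :=
  ∀ φ : ℝ × Vec n → ℝ, ContDiff ℝ ((⊤ : ℕ∞) : WithTop ℕ∞) φ → HasCompactSupport φ → ∀ t ∈ Icc (0 : ℝ) 1,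
    (∫ x, φ (t, x) * ρ t x) - ∫ x, φ (0, x) * ρ 0 x
      = ∫ s in (0 : ℝ)..t, ∫ x, ρ s x * fderiv ℝ φ (s, x) (1, V s x)

/-- The constraint set of the fluid-dynamic problem: a time-varying probability density `ρ` and a
feedback law `u` that satisfy the continuity equation and the two end-point conditions. -/
structure IsFluidPair {n m : ℕ} (A : ℝ → Matrix (Fin n) (Fin n) ℝ)
    (B : ℝ → Matrix (Fin n) (Fin m) ℝ) (ρ₀ ρ₁ : Vec n → ℝ)
    (ρ : ℝ → Vec n → ℝ) (u : ℝ → Vec n → Vec m) : Prop where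
  feedback : IsFeedbackLaw u
  measurable : Measurable fun p : ℝ × Vec n => ρ p.1 p.2
  density : ∀ t ∈ Icc (0 : ℝ) 1, IsProbDensity (ρ t)
  continuity : IsWeakContinuitySolution ρ (velocity A B u)
  initial : ∀ x, ρ 0 x = ρ₀ x
  final : ∀ x, ρ 1 x = ρ₁ x

/-- The optimal value, in `[0, ∞]`, of the fluid-dynamic problem:
the infimum of `∫ ∫₀¹ ½ ‖u(t, x)‖² ρ(t, x) dt dx`. -/
def fluidValue {n m : ℕ} (A : ℝ → Matrix (Fin n) (Fin n) ℝ)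
    (B : ℝ → Matrix (Fin n) (Fin m) ℝ) (ρ₀ ρ₁ : Vec n → ℝ) : ℝ≥0∞ :=
  ⨅ (ρ : ℝ → Vec n → ℝ) (u : ℝ → Vec n → Vec m) (_ : IsFluidPair A B ρ₀ ρ₁ ρ u),
    ∫⁻ x, ∫⁻ t in Icc (0 : ℝ) 1, ENNReal.ofReal (1 / 2 * ‖u t x‖ ^ 2 * ρ t x)

end LinearControl

end

/-!
# Stochastic control and fluid-dynamic formulations of linear-dynamics steering have equal value

Every admissible process for one problem is turned into a competitor for the other with the same
feedback law and the same energy, which is possible because the energy depends on the one-time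
marginals only (`lintegral_energy_density`, `lintegral_energy_process`).

*From a controlled process to a fluid pair* (`fluidValue_le_of_isControlled`). The closed-loop
field is locally Lipschitz, so by Grönwall's inequality the inverse flow is Lipschitz along
trajectories that stay in a ball. Hence the flow pulls Lebesgue-null sets back to null sets
(`addHaar_setOf_integralCurve_mem_eq_zero`) and every marginal has a density; the Radon-Nikodym
theorem for kernels makes the density jointly measurable (`exists_measurable_density`). The weak
continuity equation is the chain rule along trajectories, integrated (`isMeasureSolution_map`).

*From a fluid pair to a controlled process* (`stochasticControlValue_le_of_isFluidPair`). Only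
pairs of finite energy matter. For them `‖V‖ / √(1 + ‖x‖²)` is integrable against `ρ dx dt`,
although `V` has no growth bound and `ρ₀` no moments. It has to be shown that almost no trajectory
explodes and that the flow carries `ρ₀` to `ρ_t` (`exists_flow_map_eq`).

For a truncated field `W`, the function `f(s, x) = ψ(flow from s to t of x)` is constant along the
flow of `W`, so testing the continuity equation against `f` would give `∫ ψ dμ_t = ∫ ψ(flow) dμ₀`.
Two things stand in the way. First, `f` is merely Lipschitz: it is mollified in space-time, and
since `f(s + h, ·)` composed with the flow is `f(s, ·)`, the difference quotients of the
mollification in the direction `(1, W)` are controlled by the modulus of continuity of `W`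
(`IsTameField.exists_smooth_transport`). Second, `f` has no compact support and `W` differs from
`V` far out: a cutoff that is constant up to `½ log (1 + ‖x‖²) = k` and varies over the
logarithmic scale `[k, 2k]` costs only `O(1 / k)` times the total relative speed
(`exists_log_cutoff`, `IsMeasureSolution.exists_cutoff_integral_flow_le`). Letting `k → ∞`, the
image under the flow of the part of `μ₀` whose trajectories stay bounded up to time `t` is at most
`μ_t` (`map_restrict_staySet_le`).

This one-sided inequality already excludes explosion: it bounds the mean relative speed
accumulated before leaving `½ log (1 + ‖x‖²) ≤ k` independently of `k`
(`lintegral_stayRelSpeed_le`), while leaving requires an accumulated relative speed of at least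
`k - ½ log (1 + ‖x₀‖²)` (`ofReal_sub_le_stayRelSpeed`); Markov's inequality concludes
(`ae_exists_mem_staySet`). Then the image of `μ₀` under the flow is at most `μ_t`, and two
probability measures so related are equal.
-/

noncomputable section

namespace LinearControl

open Filter Topology Metric

/-! ### Integral curves and the flow of a tame vector field -/

section Flow

variable {E : Type*} [NormedAddCommGroup E] [NormedSpace ℝ E]

theorem IsIntegralCurveOn.dist_le_of_le {v : ℝ → E → E} {S : Set E} {K : ℝ≥0} {a b : ℝ}
    (hv : ∀ t ∈ Icc a b, LipschitzOnWith K (v t) S) {f g : ℝ → E}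
    (hf : IsIntegralCurveOn f v (Icc a b)) (hfS : ∀ t ∈ Icc a b, f t ∈ S)
    (hg : IsIntegralCurveOn g v (Icc a b)) (hgS : ∀ t ∈ Icc a b, g t ∈ S)
    {t₁ t₂ : ℝ} (h₁ : t₁ ∈ Icc a b) (h₂ : t₂ ∈ Icc a b) (h : t₁ ≤ t₂) :
    dist (f t₂) (g t₂) ≤ Real.exp (K * (b - a)) * dist (f t₁) (g t₁) := by
  have hsub : Icc t₁ t₂ ⊆ Icc a b := Icc_subset_Icc h₁.1 h₂.2
  have hsub' : Ico t₁ t₂ ⊆ Icc a b := Ico_subset_Icc_self.trans hsub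
  have key := dist_le_of_trajectories_ODE_of_mem (K := K) (v := v) (s := fun _ => S) (f := f)
    (g := g) (δ := dist (f t₁) (g t₁)) (fun t ht => hv t (hsub' ht)) (hf.mono hsub).continuousOn
    (fun t ht => ((hf.mono hsub) t (Ico_subset_Icc_self ht)).mono_of_mem_nhdsWithin
      (Icc_mem_nhdsGE_of_mem ht))
    (fun t ht => hfS t (hsub' ht)) (hg.mono hsub).continuousOn
    (fun t ht => ((hg.mono hsub) t (Ico_subset_Icc_self ht)).mono_of_mem_nhdsWithin
      (Icc_mem_nhdsGE_of_mem ht))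
    (fun t ht => hgS t (hsub' ht)) le_rfl t₂ ⟨h, le_rfl⟩
  refine key.trans ?_
  rw [mul_comm]
  gcongr
  · exact h₂.2
  · exact h₁.1

/-- Two integral curves of a field that is `K`-Lipschitz along both of them separate at most
exponentially, forwards as well as backwards in time. -/
theorem IsIntegralCurveOn.dist_le {v : ℝ → E → E} {S : Set E} {K : ℝ≥0} {a b : ℝ}
    (hv : ∀ t ∈ Icc a b, LipschitzOnWith K (v t) S) {f g : ℝ → E}
    (hf : IsIntegralCurveOn f v (Icc a b)) (hfS : ∀ t ∈ Icc a b, f t ∈ S)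
    (hg : IsIntegralCurveOn g v (Icc a b)) (hgS : ∀ t ∈ Icc a b, g t ∈ S)
    {t₁ t₂ : ℝ} (h₁ : t₁ ∈ Icc a b) (h₂ : t₂ ∈ Icc a b) :
    dist (f t₂) (g t₂) ≤ Real.exp (K * (b - a)) * dist (f t₁) (g t₁) := by
  rcases le_total t₁ t₂ with h | h
  · exact dist_le_of_le hv hf hfS hg hgS h₁ h₂ h
  -- reversing time turns the backward estimate into the forward one for the field `-v (-t)`
  · have hneg : ∀ t ∈ Icc (-b) (-a), -t ∈ Icc a b := fun t ht =>
      ⟨by linarith [ht.2], by linarith [ht.1]⟩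
    have rev : ∀ {y : ℝ → E}, IsIntegralCurveOn y v (Icc a b) →
        IsIntegralCurveOn (fun t => y (-t)) (fun t x => -v (-t) x) (Icc (-b) (-a)) := by
      intro y hy t ht
      have := (hy (-t) (hneg t ht)).scomp t ((hasDerivAt_neg t).hasDerivWithinAt) hneg
      simpa [Function.comp_def] using this
    have key := dist_le_of_le (K := K) (S := S) (v := fun t x => -v (-t) x) (a := -b) (b := -a)
      (fun t ht => (hv (-t) (hneg t ht)).neg)
      (rev hf) (fun t ht => hfS _ (hneg t ht)) (rev hg) (fun t ht => hgS _ (hneg t ht))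
      (t₁ := -t₁) (t₂ := -t₂) ⟨by linarith [h₁.2], by linarith [h₁.1]⟩
      ⟨by linarith [h₂.2], by linarith [h₂.1]⟩ (by linarith)
    have e : -a - -b = b - a := by ring
    simpa [e] using key

/-- A time-dependent vector field that is bounded, Lipschitz in space and uniformly continuous in
space-time, so that it has a global flow. -/
structure IsTameField (W : ℝ → E → E) (K M : ℝ≥0) : Prop where
  lipschitz : ∀ t, LipschitzWith K (W t)
  norm_le : ∀ t x, ‖W t x‖ ≤ M
  uniformContinuous : UniformContinuous fun p : ℝ × E => W p.1 p.2

namespace IsTameField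

variable {W : ℝ → E → E} {K M : ℝ≥0}

theorem exists_flow [CompleteSpace E] (hW : IsTameField W K M) :
    ∃ Y : ℝ → E → ℝ → E, ∀ s ∈ Icc (-1 : ℝ) 2, ∀ x, Y s x s = x ∧
      IsIntegralCurveOn (Y s x) W (Icc (-1) 2) := by
  have key : ∀ (s : ℝ) (x : E), ∃ y : ℝ → E, s ∈ Icc (-1 : ℝ) 2 →
      y s = x ∧ IsIntegralCurveOn y W (Icc (-1) 2) := by
    intro s x
    by_cases hs : s ∈ Icc (-1 : ℝ) 2
    -- a curve of speed at most `M` stays within `3 M` of its start, so one ball suffices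
    · have hPL : IsPicardLindelof W (⟨s, hs⟩ : Icc (-1 : ℝ) 2) x (M * 3) 0 M K :=
        { lipschitzOnWith := fun t _ => (hW.lipschitz t).lipschitzOnWith
          continuousOn := fun y _ => (hW.uniformContinuous.continuous.comp
            (Continuous.prodMk_left y)).continuousOn
          norm_le := fun t _ y _ => hW.norm_le t y
          mul_max_le := by
            push_cast
            rw [sub_zero]
            gcongr
            exact max_le (by linarith [hs.1]) (by linarith [hs.2]) }
      obtain ⟨y, h0, hy⟩ := hPL.exists_eq_forall_mem_Icc_hasDerivWithinAt₀
      exact ⟨y, fun _ => ⟨h0, hy⟩⟩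
    · exact ⟨0, fun h => absurd h hs⟩
  choose Y hY using key
  exact ⟨Y, fun s hs x => hY s x hs⟩

variable [CompleteSpace E]

/-- The flow of a tame field on the time interval `[-1, 2]`: `hW.flow s x` is the integral curve
that passes through `x` at time `s`.  The interval exceeds `[0, 1]` so that functions transported by
the flow can be mollified in time. -/
def flow (hW : IsTameField W K M) : ℝ → E → ℝ → E := hW.exists_flow.choose

theorem flow_self (hW : IsTameField W K M) {s : ℝ} (hs : s ∈ Icc (-1 : ℝ) 2) (x : E) :
    hW.flow s x s = x := (hW.exists_flow.choose_spec s hs x).1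

theorem isIntegralCurveOn_flow (hW : IsTameField W K M) {s : ℝ} (hs : s ∈ Icc (-1 : ℝ) 2) (x : E) :
    IsIntegralCurveOn (hW.flow s x) W (Icc (-1) 2) := (hW.exists_flow.choose_spec s hs x).2

theorem eq_flow (hW : IsTameField W K M) {a b : ℝ} (hab : Icc a b ⊆ Icc (-1 : ℝ) 2) {y : ℝ → E}
    (hy : IsIntegralCurveOn y W (Icc a b)) {s t : ℝ} (hs : s ∈ Icc a b) (ht : t ∈ Icc a b) :
    y t = hW.flow s (y s) t := by
  have := IsIntegralCurveOn.dist_le (S := univ) (fun r _ => (hW.lipschitz r).lipschitzOnWith)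
    hy (fun _ _ => trivial) ((hW.isIntegralCurveOn_flow (hab hs) (y s)).mono hab)
    (fun _ _ => trivial) hs ht
  rw [hW.flow_self (hab hs), dist_self, mul_zero] at this
  exact dist_le_zero.1 this

theorem flow_flow (hW : IsTameField W K M) {s r t : ℝ} (hs : s ∈ Icc (-1 : ℝ) 2)
    (hr : r ∈ Icc (-1 : ℝ) 2) (ht : t ∈ Icc (-1 : ℝ) 2) (x : E) :
    hW.flow r (hW.flow s x r) t = hW.flow s x t :=
  (hW.eq_flow Subset.rfl (hW.isIntegralCurveOn_flow hs x) hr ht).symm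

theorem dist_flow_flow_le (hW : IsTameField W K M) {s t : ℝ} (hs : s ∈ Icc (-1 : ℝ) 2)
    (ht : t ∈ Icc (-1 : ℝ) 2) (x y : E) :
    dist (hW.flow s x t) (hW.flow s y t) ≤ Real.exp (K * 3) * dist x y := by
  have := IsIntegralCurveOn.dist_le (S := univ) (fun r _ => (hW.lipschitz r).lipschitzOnWith)
    (hW.isIntegralCurveOn_flow hs x) (fun _ _ => trivial)
    (hW.isIntegralCurveOn_flow hs y) (fun _ _ => trivial) hs ht
  rw [hW.flow_self hs, hW.flow_self hs] at this
  convert this using 3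
  norm_num

theorem continuous_flow_right (hW : IsTameField W K M) {s t : ℝ} (hs : s ∈ Icc (-1 : ℝ) 2)
    (ht : t ∈ Icc (-1 : ℝ) 2) : Continuous fun x => hW.flow s x t :=
  (LipschitzWith.of_dist_le_mul (K := ⟨Real.exp (K * 3), (Real.exp_pos _).le⟩)
    (hW.dist_flow_flow_le hs ht)).continuous

theorem dist_flow_time_le (hW : IsTameField W K M) {s r t : ℝ} (hs : s ∈ Icc (-1 : ℝ) 2)
    (hr : r ∈ Icc (-1 : ℝ) 2) (ht : t ∈ Icc (-1 : ℝ) 2) (x : E) :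
    dist (hW.flow s x r) (hW.flow s x t) ≤ M * |r - t| := by
  rw [dist_eq_norm]
  exact (convex_Icc (-1 : ℝ) 2).norm_image_sub_le_of_norm_hasDerivWithin_le
    (hW.isIntegralCurveOn_flow hs x) (fun _ _ => hW.norm_le _ _) ht hr

/-- Over a short time the flow moves with almost the velocity seen at any nearby point `p`. -/
theorem norm_flow_sub_le (hW : IsTameField W K M) {δ η : ℝ}
    (hδ : ∀ p q : ℝ × E, dist p q < η → dist (W p.1 p.2) (W q.1 q.2) < δ)
    {s h : ℝ} (hs : s ∈ Icc (-1 : ℝ) 2) (hsh : s + h ∈ Icc (-1 : ℝ) 2) {x : E} {p : ℝ × E}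
    (hp : dist (s, x) p + |h| * (1 + M) < η) :
    ‖x + h • W p.1 p.2 - hW.flow s x (s + h)‖ ≤ δ * |h| := by
  have hsub : uIcc s (s + h) ⊆ Icc (-1 : ℝ) 2 := uIcc_subset_Icc hs hsh
  have hd : ∀ r ∈ uIcc s (s + h), HasDerivWithinAt
      (fun r => (r - s) • W p.1 p.2 - hW.flow s x r)
      (W p.1 p.2 - W r (hW.flow s x r)) (uIcc s (s + h)) r := by
    intro r hr
    have h1 : HasDerivWithinAt (fun r : ℝ => (r - s) • W p.1 p.2) ((1 : ℝ) • W p.1 p.2)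
        (uIcc s (s + h)) r :=
      (((hasDerivAt_id r).sub_const s).smul_const (W p.1 p.2)).hasDerivWithinAt
    rw [one_smul] at h1
    exact h1.sub ((hW.isIntegralCurveOn_flow hs x).mono hsub r hr)
  have hb : ∀ r ∈ uIcc s (s + h), ‖W p.1 p.2 - W r (hW.flow s x r)‖ ≤ δ := by
    intro r hr
    rw [← dist_eq_norm]
    refine (hδ p (r, hW.flow s x r) ?_).le
    have hrs : |s - r| ≤ |h| := by
      rw [abs_sub_comm]
      have := abs_sub_left_of_mem_uIcc hr
      simpa using this
    have h2 : dist (s, x) (r, hW.flow s x r) ≤ |h| * (1 + M) := by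
      rw [Prod.dist_eq]
      refine max_le ?_ ?_
      · rw [Real.dist_eq]
        refine hrs.trans ?_
        have := mul_nonneg (abs_nonneg h) M.2
        change |h| ≤ |h| * (1 + M)
        rw [mul_add, mul_one]
        exact le_add_of_nonneg_right this
      · have := hW.dist_flow_time_le hs hs (hsub hr) x
        rw [hW.flow_self hs] at this
        refine this.trans ?_
        have h3 : (M : ℝ) * |s - r| ≤ M * |h| := by gcongr
        have := abs_nonneg h
        nlinarith
    calc dist p (r, hW.flow s x r) ≤ dist p (s, x) + dist (s, x) (r, hW.flow s x r) :=
          dist_triangle _ _ _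
      _ ≤ dist (s, x) p + |h| * (1 + M) := by rw [dist_comm]; gcongr
      _ < η := hp
  have := (convex_uIcc s (s + h)).norm_image_sub_le_of_norm_hasDerivWithin_le hd hb
    left_mem_uIcc right_mem_uIcc
  simp only [add_sub_cancel_left, sub_self, zero_smul, hW.flow_self hs, Real.norm_eq_abs] at this
  convert this using 2
  abel

end IsTameField

end Flow

/-! ### Mollified backward transport -/

section Mollify

open ContinuousLinearMap Convolution

/-- A mollified function inherits directional difference quotient bounds: if `F` varies by at most
`C |h|` along `h • w` near `p`, then the mollification has derivative at most `C` at `p` along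
`w`. -/
theorem abs_fderiv_convolution_normed_le {G : Type*} [NormedAddCommGroup G] [NormedSpace ℝ G]
    [FiniteDimensional ℝ G] [MeasurableSpace G] [BorelSpace G] (μ : Measure G)
    [μ.IsAddHaarMeasure] (φ : ContDiffBump (0 : G)) {F : G → ℝ} (hF : Continuous F) {p w : G}
    {C h₀ : ℝ} (hC : 0 ≤ C) (hh₀ : 0 < h₀)
    (H : ∀ q ∈ ball p φ.rOut, ∀ h : ℝ, |h| < h₀ → |F (q + h • w) - F q| ≤ C * |h|) :
    |fderiv ℝ (φ.normed μ ⋆[lsmul ℝ ℝ, μ] F) p w| ≤ C := by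
  set g : G → ℝ := φ.normed μ ⋆[lsmul ℝ ℝ, μ] F with hg
  have hgd : ContDiff ℝ 1 g :=
    φ.hasCompactSupport_normed.contDiff_convolution_left _ φ.contDiff_normed
      hF.locallyIntegrable
  have hint : ∀ x : G, Integrable (fun t => φ.normed μ t * F (x - t)) μ := fun x =>
    (φ.continuous_normed.mul
      (hF.comp (continuous_const.sub continuous_id))).integrable_of_hasCompactSupport
        (φ.hasCompactSupport_normed.mul_right)
  have hval : ∀ x : G, g x = ∫ t, φ.normed μ t * F (x - t) ∂μ := fun x => rfl
  have hbd : ∀ h : ℝ, |h| < h₀ → |g (p + h • w) - g p| ≤ C * |h| := by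
    intro h hh
    rw [hval, hval, ← integral_sub (hint _) (hint _), ← Real.norm_eq_abs]
    have h1 : ∫ t, φ.normed μ t * (C * |h|) ∂μ = C * |h| := by
      rw [integral_mul_const, φ.integral_normed, one_mul]
    refine (norm_integral_le_of_norm_le (g := fun t => φ.normed μ t * (C * |h|))
      (φ.integrable_normed.mul_const _) (Eventually.of_forall fun t => ?_)).trans h1.le
    rw [← mul_sub, norm_mul, Real.norm_of_nonneg (φ.nonneg_normed t)]
    by_cases ht : t ∈ ball (0 : G) φ.rOut
    · refine mul_le_mul_of_nonneg_left ?_ (φ.nonneg_normed t)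
      have h2 := H (p - t) (by simpa [mem_ball, dist_eq_norm] using ht) h hh
      rwa [sub_add_eq_add_sub] at h2
    · have : φ.normed μ t = 0 := by
        rw [← Function.notMem_support, φ.support_normed_eq]; exact ht
      simp [this]
  have hline : HasDerivAt (fun h : ℝ => g (p + h • w)) (fderiv ℝ g p w) 0 := by
    have h1 : HasDerivAt (fun h : ℝ => p + h • w) w 0 := by
      simpa using ((hasDerivAt_id (0 : ℝ)).smul_const w).const_add p
    have h2 : HasFDerivAt g (fderiv ℝ g p) (p + (0 : ℝ) • w) := by
      simpa using (hgd.differentiable one_ne_zero p).hasFDerivAt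
    exact h2.comp_hasDerivAt (0 : ℝ) h1
  have := hline.le_of_lip' hC (by
    filter_upwards [Metric.ball_mem_nhds (0 : ℝ) hh₀] with h hh
    simpa using hbd h (by simpa using hh))
  exact this

/-- Backward transport, mollified: for a bounded Lipschitz `ψ`, the function
`(s, x) ↦ ψ (flow from time s to time t of x)`, which is constant along the flow of `W`, is a
uniform limit of smooth functions whose derivatives along `(1, W)` are uniformly small. -/
theorem IsTameField.exists_smooth_transport {E : Type*} [NormedAddCommGroup E] [NormedSpace ℝ E]
    [FiniteDimensional ℝ E] {W : ℝ → E → E} {K M : ℝ≥0}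
    (hW : IsTameField W K M) {ψ : E → ℝ} {L : ℝ≥0} (hψ : LipschitzWith L ψ)
    (hψ1 : ∀ x, |ψ x| ≤ 1) {t : ℝ} (ht : t ∈ Icc (0 : ℝ) 1) {δ : ℝ} (hδ : 0 < δ) :
    ∃ g : ℝ × E → ℝ, ContDiff ℝ ((⊤ : ℕ∞) : WithTop ℕ∞) g ∧ (∀ p, |g p| ≤ 1 + δ) ∧
      (∀ s ∈ Icc (0 : ℝ) 1, ∀ x, |g (s, x) - ψ (hW.flow s x t)| ≤ δ) ∧
      ∀ s ∈ Icc (0 : ℝ) 1, ∀ x, |fderiv ℝ g (s, x) (1, W s x)| ≤ δ := by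
  let _ : MeasurableSpace E := borel E
  have : BorelSpace E := ⟨rfl⟩
  let μ : Measure (ℝ × E) := Measure.addHaar
  have ht' : t ∈ Icc (-1 : ℝ) 2 := ⟨by linarith [ht.1], by linarith [ht.2]⟩
  have h12 : (-1 : ℝ) ≤ 2 := by norm_num
  let F : ℝ × E → ℝ := fun p => ψ (hW.flow (projIcc (-1 : ℝ) 2 h12 p.1) p.2 t)
  set A : ℝ := L * Real.exp (K * 3) with hA
  have hA0 : 0 ≤ A := by positivity
  -- `F` is Lipschitz in space-time
  have hFlip : ∀ p q : ℝ × E, |F p - F q| ≤ A * (1 + M) * dist p q := by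
    intro p q
    set s := projIcc (-1 : ℝ) 2 h12 p.1
    set r := projIcc (-1 : ℝ) 2 h12 q.1
    have hsr : |(s : ℝ) - r| ≤ dist p q :=
      (abs_projIcc_sub_projIcc h12).trans (le_max_left (dist p.1 q.1) (dist p.2 q.2))
    have h1 : hW.flow r q.2 t = hW.flow s (hW.flow r q.2 s) t :=
      (hW.flow_flow r.2 s.2 ht' q.2).symm
    have h2 : dist p.2 (hW.flow r q.2 s) ≤ (1 + M) * dist p q := by
      have h3 := hW.dist_flow_time_le r.2 r.2 s.2 q.2
      rw [hW.flow_self r.2, abs_sub_comm] at h3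
      have h4 : dist p.2 q.2 ≤ dist p q := le_max_right (dist p.1 q.1) (dist p.2 q.2)
      calc dist p.2 (hW.flow r q.2 s) ≤ dist p.2 q.2 + dist q.2 (hW.flow r q.2 s) :=
            dist_triangle _ _ _
        _ ≤ dist p q + M * dist p q := by gcongr; exact h3.trans (by gcongr)
        _ = (1 + M) * dist p q := by ring
    calc |F p - F q| = dist (ψ (hW.flow s p.2 t)) (ψ (hW.flow s (hW.flow r q.2 s) t)) := by
          rw [← h1, Real.dist_eq]
      _ ≤ L * dist (hW.flow s p.2 t) (hW.flow s (hW.flow r q.2 s) t) := hψ.dist_le_mul _ _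
      _ ≤ L * (Real.exp (K * 3) * ((1 + M) * dist p q)) := by
          gcongr
          exact (hW.dist_flow_flow_le s.2 ht' _ _).trans (by gcongr)
      _ = A * (1 + M) * dist p q := by rw [hA]; ring
  have hFc : Continuous F := by
    have : LipschitzWith ⟨A * (1 + M), by positivity⟩ F :=
      LipschitzWith.of_dist_le_mul fun p q => by rw [Real.dist_eq]; exact hFlip p q
    exact this.continuous
  -- a modulus of continuity of the field
  obtain ⟨η, hη, hmod⟩ := Metric.uniformContinuous_iff.1 hW.uniformContinuous (δ / (A + 1))
    (by positivity)
  set ε : ℝ := min (min (η / 2) (1 / 2)) (δ / (A * (1 + M) + 1)) with hε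
  have hε0 : 0 < ε := by positivity
  have hεη : ε ≤ η / 2 := (min_le_left _ _).trans (min_le_left _ _)
  have hε1 : ε ≤ 1 / 2 := (min_le_left _ _).trans (min_le_right _ _)
  have hεδ : A * (1 + M) * ε ≤ δ := by
    have h1 : ε ≤ δ / (A * (1 + M) + 1) := min_le_right _ _
    rw [le_div_iff₀ (by positivity)] at h1
    nlinarith
  let φ : ContDiffBump (0 : ℝ × E) := ⟨ε / 2, ε, by positivity, by linarith⟩
  have happrox : ∀ p, |(φ.normed μ ⋆[lsmul ℝ ℝ, μ] F) p - F p| ≤ δ := by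
    intro p
    have := φ.dist_normed_convolution_le (μ := μ) (g := F) (x₀ := p) (ε := δ)
      hFc.aestronglyMeasurable (fun q hq => by
        rw [Real.dist_eq]
        refine (hFlip q p).trans (le_trans ?_ hεδ)
        gcongr
        exact (mem_ball.1 hq).le)
    rwa [Real.dist_eq] at this
  refine ⟨φ.normed μ ⋆[lsmul ℝ ℝ, μ] F, ?_, ?_, ?_, ?_⟩
  · exact φ.hasCompactSupport_normed.contDiff_convolution_left _ φ.contDiff_normed
      hFc.locallyIntegrable
  · intro p
    have h1 := happrox p
    have h2 : |F p| ≤ 1 := hψ1 _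
    rw [abs_le] at *
    constructor <;> linarith
  · intro s hs x
    have h1 := happrox (s, x)
    have : (projIcc (-1 : ℝ) 2 h12 s : ℝ) = s :=
      congrArg Subtype.val (projIcc_of_mem h12 ⟨by linarith [hs.1], by linarith [hs.2]⟩)
    simpa only [F, this] using h1
  · intro s hs x
    set h₀ : ℝ := min (1 / 2) (η / (4 * (1 + M))) with hh₀
    refine abs_fderiv_convolution_normed_le μ φ hFc hδ.le (h₀ := h₀) (by positivity) ?_
    rintro ⟨s', x'⟩ hq h hh
    have hq' : dist (s', x') (s, x) < ε := hq
    have hs's : |s' - s| < ε := by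
      exact (le_max_left (dist s' s) (dist x' x)).trans_lt hq'
    rw [abs_lt] at hs's
    have hh1 : |h| < 1 / 2 := hh.trans_le (min_le_left _ _)
    have hh2 : |h| * (1 + M) ≤ η / 4 := by
      have : |h| ≤ η / (4 * (1 + M)) := (hh.trans_le (min_le_right _ _)).le
      rw [le_div_iff₀ (by positivity)] at this
      linarith
    have hhb := abs_lt.1 hh1
    have hs'J : s' ∈ Icc (-1 : ℝ) 2 := ⟨by linarith [hs.1], by linarith [hs.2]⟩
    have hs'hJ : s' + h ∈ Icc (-1 : ℝ) 2 := ⟨by linarith [hs.1], by linarith [hs.2]⟩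
    have hstep := hW.norm_flow_sub_le (x := x') (p := (s, x))
      (fun p q hpq => hmod hpq) hs'J hs'hJ (by linarith)
    have e1 : F ((s', x') + h • ((1 : ℝ), W s x)) = ψ (hW.flow (s' + h) (x' + h • W s x) t) := by
      simp only [F, Prod.smul_mk, Prod.mk_add_mk, smul_eq_mul, mul_one, projIcc_of_mem h12 hs'hJ]
    -- the value of `F` at `(s', x')` is its value further along the trajectory
    have e2 : F (s', x') = ψ (hW.flow (s' + h) (hW.flow s' x' (s' + h)) t) := by
      simp only [F, projIcc_of_mem h12 hs'J, hW.flow_flow hs'J hs'hJ ht']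
    rw [e1, e2, ← Real.dist_eq]
    calc _ ≤ L * dist (hW.flow (s' + h) (x' + h • W s x) t)
          (hW.flow (s' + h) (hW.flow s' x' (s' + h)) t) := hψ.dist_le_mul _ _
      _ ≤ L * (Real.exp (K * 3) * (δ / (A + 1) * |h|)) := by
          gcongr
          refine (hW.dist_flow_flow_le hs'hJ ht' _ _).trans ?_
          gcongr
          rwa [dist_eq_norm]
      _ = (A / (A + 1)) * δ * |h| := by rw [hA]; ring
      _ ≤ δ * |h| := by
          have : A / (A + 1) ≤ 1 := (div_le_one (by positivity)).2 (by linarith)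
          gcongr
          exact mul_le_of_le_one_left hδ.le this

end Mollify

/-! ### Logarithmic cutoffs, truncation of vector fields, the closed-loop velocity -/

section Cutoff

variable {E : Type*} [NormedAddCommGroup E]

/-- The smooth logarithmic size `½ log (1 + ‖x‖²)` of a vector. -/
def logSize (x : E) : ℝ := 1 / 2 * Real.log (1 + ‖x‖ ^ 2)

/-- The speed `‖v‖ / √(1 + ‖x‖²)` of a velocity `v` at `x`, relative to the size of `x`; it bounds
the rate of change of `logSize` along `v`. -/
def relSpeed (x v : E) : ℝ := ‖v‖ / √(1 + ‖x‖ ^ 2)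

theorem logSize_nonneg (x : E) : 0 ≤ logSize x :=
  mul_nonneg (by norm_num) (Real.log_nonneg (by nlinarith [sq_nonneg ‖x‖]))

theorem norm_le_of_logSize_le {x : E} {k : ℝ} (h : logSize x ≤ k) : ‖x‖ ≤ Real.exp k := by
  have h1 : Real.log (1 + ‖x‖ ^ 2) ≤ 2 * k := by unfold logSize at h; linarith
  rw [Real.log_le_iff_le_exp (by positivity), two_mul, Real.exp_add, ← sq] at h1
  exact abs_le_of_sq_le_sq' (by linarith) (Real.exp_pos k).le |>.2

theorem relSpeed_nonneg (x v : E) : 0 ≤ relSpeed x v := by unfold relSpeed; positivity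

variable [InnerProductSpace ℝ E]

theorem contDiff_logSize : ContDiff ℝ ((⊤ : ℕ∞) : WithTop ℕ∞) (logSize : E → ℝ) :=
  contDiff_const.mul ((contDiff_const.add (contDiff_norm_sq ℝ)).log
    fun x => ne_of_gt (by positivity))

theorem continuous_logSize : Continuous (logSize : E → ℝ) := contDiff_logSize.continuous

theorem hasFDerivAt_logSize (x : E) :
    HasFDerivAt logSize ((1 + ‖x‖ ^ 2)⁻¹ • innerSL ℝ x) x := by
  have h1 : HasFDerivAt (fun y : E => 1 + ‖y‖ ^ 2) (2 • innerSL ℝ x) x :=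
    (hasStrictFDerivAt_norm_sq x).hasFDerivAt.const_add 1
  have h2 := (h1.log (ne_of_gt (by positivity))).const_mul (1 / 2 : ℝ)
  have e : (1 + ‖x‖ ^ 2)⁻¹ • innerSL ℝ x
      = (1 / 2 : ℝ) • (1 + ‖x‖ ^ 2)⁻¹ • (2 : ℕ) • innerSL ℝ x := by
    ext v
    simp
    ring
  rw [e]
  exact h2

theorem abs_fderiv_logSize_le (x v : E) : |fderiv ℝ logSize x v| ≤ relSpeed x v := by
  rw [(hasFDerivAt_logSize x).fderiv]
  have hpos : 0 < 1 + ‖x‖ ^ 2 := by positivity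
  have h1 : ‖x‖ ≤ √(1 + ‖x‖ ^ 2) := Real.le_sqrt_of_sq_le (by linarith)
  have h2 : √(1 + ‖x‖ ^ 2) * √(1 + ‖x‖ ^ 2) = 1 + ‖x‖ ^ 2 := Real.mul_self_sqrt hpos.le
  have hs : 0 < √(1 + ‖x‖ ^ 2) := Real.sqrt_pos.2 hpos
  simp only [_root_.smul_apply, innerSL_apply_apply, smul_eq_mul, relSpeed]
  rw [abs_mul, abs_of_pos (inv_pos.2 hpos), le_div_iff₀ hs]
  calc (1 + ‖x‖ ^ 2)⁻¹ * |inner ℝ x v| * √(1 + ‖x‖ ^ 2)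
      ≤ (1 + ‖x‖ ^ 2)⁻¹ * (√(1 + ‖x‖ ^ 2) * ‖v‖) * √(1 + ‖x‖ ^ 2) := by
        gcongr
        exact (abs_real_inner_le_norm x v).trans (by gcongr)
    _ = (1 + ‖x‖ ^ 2)⁻¹ * (√(1 + ‖x‖ ^ 2) * √(1 + ‖x‖ ^ 2)) * ‖v‖ := by ring
    _ = ‖v‖ := by rw [h2, inv_mul_cancel₀ hpos.ne', one_mul]

/-- Logarithmic cutoffs: smooth functions equal to `1` where `logSize ≤ k` and to `0` where
`logSize ≥ 2k`, whose derivative along `v` is `O(1 / k)` times the relative speed of `v`. -/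
theorem exists_log_cutoff (E : Type*) [NormedAddCommGroup E] [InnerProductSpace ℝ E]
    [FiniteDimensional ℝ E] : ∃ C : ℝ, 0 ≤ C ∧ ∀ k : ℝ, 1 ≤ k →
    ∃ χ : E → ℝ, ContDiff ℝ ((⊤ : ℕ∞) : WithTop ℕ∞) χ ∧ HasCompactSupport χ ∧
      (∀ x, 0 ≤ χ x) ∧ (∀ x, χ x ≤ 1) ∧ (∀ x, logSize x ≤ k → χ x = 1) ∧
      (∀ x, 2 * k < logSize x → χ x = 0 ∧ fderiv ℝ χ x = 0) ∧
      ∀ x v, |fderiv ℝ χ x v| ≤ C / k * relSpeed x v := by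
  let b : ContDiffBump (0 : ℝ) := ⟨1, 2, by norm_num, by norm_num⟩
  have hbd : Differentiable ℝ b := (b.contDiff (n := 1)).differentiable one_ne_zero
  obtain ⟨C, hC⟩ := (b.hasCompactSupport.deriv).exists_bound_of_continuous
    ((b.contDiff (n := 1)).continuous_deriv le_rfl)
  have hC0 : 0 ≤ C := (norm_nonneg _).trans (hC 0)
  refine ⟨C, hC0, fun k hk => ?_⟩
  have hk0 : 0 < k := by linarith
  have habs : ∀ x : E, |logSize x / k| = logSize x / k := fun x =>
    abs_of_nonneg (div_nonneg (logSize_nonneg x) hk0.le)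
  have hzero : ∀ x : E, 2 * k < logSize x → b (logSize x / k) = 0 := fun x hx => by
    refine b.zero_of_le_dist ?_
    rw [Real.dist_eq, sub_zero, habs, le_div_iff₀ hk0]
    exact hx.le
  have hfd : ∀ x : E, HasFDerivAt (fun x : E => b (logSize x / k))
      (deriv b (logSize x / k) • (k⁻¹ • fderiv ℝ logSize x)) x := fun x => by
    have h1 : HasFDerivAt (fun x : E => logSize x / k) (k⁻¹ • fderiv ℝ logSize x) x := by
      have := ((hasFDerivAt_logSize x).differentiableAt.hasFDerivAt).const_mul k⁻¹
      simpa only [div_eq_inv_mul] using this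
    exact (hbd _).hasDerivAt.comp_hasFDerivAt x h1
  refine ⟨fun x => b (logSize x / k), b.contDiff.comp (contDiff_logSize.div_const k), ?_,
    fun x => b.nonneg, fun x => b.le_one, fun x hx => ?_, fun x hx => ⟨hzero x hx, ?_⟩,
    fun x v => ?_⟩
  · refine HasCompactSupport.intro (isCompact_closedBall (0 : E) (Real.exp (2 * k))) fun x hx => ?_
    refine hzero x (lt_of_not_ge fun h => hx ?_)
    simpa using norm_le_of_logSize_le h
  · refine b.one_of_mem_closedBall ?_
    rw [mem_closedBall, Real.dist_eq, sub_zero, habs, div_le_iff₀ hk0]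
    simpa [b] using hx
  · have : (fun x : E => b (logSize x / k)) =ᶠ[𝓝 x] fun _ => 0 := by
      filter_upwards [(isOpen_lt continuous_const continuous_logSize).mem_nhds hx] with y hy
      exact hzero y hy
    rw [this.fderiv_eq, fderiv_const_apply]
  · rw [(hfd x).fderiv]
    simp only [_root_.smul_apply, smul_eq_mul, abs_mul, abs_of_pos (inv_pos.2 hk0)]
    rw [div_eq_mul_inv C, mul_assoc C]
    gcongr
    · exact hC _
    · exact abs_fderiv_logSize_le x v

end Cutoff

section Truncation

variable {n : ℕ}

/-- Coordinatewise clamping of a vector to the cube `[-r, r]ⁿ`. -/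
def clamp (r : ℝ) (x : Vec n) : Vec n := WithLp.toLp 2 fun i => max (-r) (min r (x i))

theorem clamp_of_norm_le {r : ℝ} {x : Vec n} (hx : ‖x‖ ≤ r) : clamp r x = x := by
  ext i
  have h := abs_le.1 ((PiLp.norm_apply_le x i).trans hx)
  simp [clamp, min_eq_right h.2, max_eq_right h.1]

theorem dist_clamp_le (r : ℝ) (x y : Vec n) : dist (clamp r x) (clamp r y) ≤ dist x y := by
  rw [EuclideanSpace.dist_eq, EuclideanSpace.dist_eq]
  refine Real.sqrt_le_sqrt (Finset.sum_le_sum fun i _ => ?_)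
  gcongr
  simpa [clamp] using ((LipschitzWith.id.const_min r).const_max (-r)).dist_le_mul (x i) (y i)

theorem norm_clamp_le {r : ℝ} (hr : 0 ≤ r) (x : Vec n) : ‖clamp r x‖ ≤ √(n * r ^ 2) := by
  rw [EuclideanSpace.norm_eq]
  refine Real.sqrt_le_sqrt ?_
  calc ∑ i, ‖(clamp r x) i‖ ^ 2 ≤ ∑ _i : Fin n, r ^ 2 := by
        refine Finset.sum_le_sum fun i _ => ?_
        gcongr
        rw [Real.norm_eq_abs, abs_le]
        exact ⟨le_max_left _ _, max_le (by linarith) (min_le_left _ _)⟩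
    _ = n * r ^ 2 := by simp

/-- A field that is locally Lipschitz in space agrees on `[0, 1]` and on any given ball with a tame
field. -/
theorem exists_isTameField_eqOn {V : ℝ → Vec n → Vec n}
    (hVc : ContinuousOn (fun p : ℝ × Vec n => V p.1 p.2) (Icc (0 : ℝ) 1 ×ˢ univ))
    (hVL : ∀ R : ℝ, ∃ K : ℝ≥0, ∀ t ∈ Icc (0 : ℝ) 1, LipschitzOnWith K (V t) (closedBall 0 R))
    {r : ℝ} (hr : 0 ≤ r) :
    ∃ (W : ℝ → Vec n → Vec n) (K M : ℝ≥0), IsTameField W K M ∧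
      ∀ t ∈ Icc (0 : ℝ) 1, ∀ x, ‖x‖ ≤ r → W t x = V t x := by
  obtain ⟨K, hK⟩ := hVL √(n * r ^ 2)
  have hmem : ∀ x : Vec n, clamp r x ∈ closedBall (0 : Vec n) √(n * r ^ 2) := fun x => by
    simpa using norm_clamp_le hr x
  set S : Set (ℝ × Vec n) := Icc (0 : ℝ) 1 ×ˢ closedBall 0 √(n * r ^ 2)
  have hS : IsCompact S := isCompact_Icc.prod (isCompact_closedBall _ _)
  have hVS : ContinuousOn (fun p : ℝ × Vec n => V p.1 p.2) S :=
    hVc.mono (prod_mono Subset.rfl (subset_univ _))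
  obtain ⟨M, hM⟩ := hS.exists_bound_of_continuousOn hVS
  -- the tame field is `V` precomposed with a `1`-Lipschitz retraction `Q` onto a compact set
  let Q : ℝ × Vec n → ℝ × Vec n := fun p => (projIcc (0 : ℝ) 1 zero_le_one p.1, clamp r p.2)
  have hQ : ∀ p, Q p ∈ S := fun p => ⟨(projIcc (0 : ℝ) 1 zero_le_one p.1).2, hmem p.2⟩
  have hQL : ∀ p q, dist (Q p) (Q q) ≤ dist p q := fun p q => by
    rw [Prod.dist_eq, Prod.dist_eq]
    exact max_le_max (abs_projIcc_sub_projIcc zero_le_one) (dist_clamp_le r _ _)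
  refine ⟨fun t x => V (Q (t, x)).1 (Q (t, x)).2, K, M.toNNReal, ⟨fun t => ?_, fun t x => ?_, ?_⟩,
    fun t ht x hx => ?_⟩
  · refine LipschitzWith.of_dist_le_mul fun x y => ?_
    refine ((hK _ (hQ (t, x)).1).dist_le_mul _ (hmem x) _ (hmem y)).trans ?_
    gcongr
    exact dist_clamp_le r x y
  · exact (hM _ (hQ (t, x))).trans (Real.le_coe_toNNReal M)
  · have hu := hS.uniformContinuousOn_of_continuous hVS
    rw [Metric.uniformContinuousOn_iff] at hu
    rw [Metric.uniformContinuous_iff]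
    intro ε hε
    obtain ⟨δ, hδ, h⟩ := hu ε hε
    exact ⟨δ, hδ, fun p q hpq => h _ (hQ p) _ (hQ q) ((hQL p q).trans_lt hpq)⟩
  · simp only [Q, projIcc_of_mem zero_le_one ht, clamp_of_norm_le hx]

end Truncation

section Velocity

variable {n m : ℕ}

/-- A matrix as a continuous linear map between Euclidean spaces. -/
def matrixCLM (a b : ℕ) : Matrix (Fin a) (Fin b) ℝ →ₗ[ℝ] Vec b →L[ℝ] Vec a :=
  LinearMap.toContinuousLinearMap.toLinearMap ∘ₗ (Matrix.toLpLin 2 2).toLinearMap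

theorem continuous_matrixCLM (a b : ℕ) : Continuous (matrixCLM a b) :=
  LinearMap.continuous_of_finiteDimensional _

theorem velocity_eq (A : ℝ → Matrix (Fin n) (Fin n) ℝ) (B : ℝ → Matrix (Fin n) (Fin m) ℝ)
    (u : ℝ → Vec n → Vec m) (t : ℝ) (x : Vec n) :
    velocity A B u t x = matrixCLM n n (A t) x + matrixCLM n m (B t) (u t x) := rfl

variable {A : ℝ → Matrix (Fin n) (Fin n) ℝ} {B : ℝ → Matrix (Fin n) (Fin m) ℝ}
  {u : ℝ → Vec n → Vec m}

theorem exists_norm_matrixCLM_le {a b : ℕ} {A : ℝ → Matrix (Fin a) (Fin b) ℝ}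
    (hA : ContinuousOn A (Icc 0 1)) :
    ∃ C : ℝ≥0, ∀ t ∈ Icc (0 : ℝ) 1, ‖matrixCLM a b (A t)‖ ≤ C := by
  obtain ⟨C, hC⟩ := isCompact_Icc.exists_bound_of_continuousOn
    ((continuous_matrixCLM a b).comp_continuousOn hA)
  exact ⟨C.toNNReal, fun t ht => (hC t ht).trans (Real.le_coe_toNNReal C)⟩

theorem continuousOn_velocity (hA : ContinuousOn A (Icc 0 1)) (hB : ContinuousOn B (Icc 0 1))
    (hu : IsFeedbackLaw u) :
    ContinuousOn (fun p : ℝ × Vec n => velocity A B u p.1 p.2) (Icc (0 : ℝ) 1 ×ˢ univ) := by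
  have hf : ContinuousOn (fun p : ℝ × Vec n => p.1) (Icc (0 : ℝ) 1 ×ˢ univ) :=
    continuous_fst.continuousOn
  have hm : MapsTo (fun p : ℝ × Vec n => p.1) (Icc (0 : ℝ) 1 ×ˢ univ) (Icc 0 1) := fun p hp => hp.1
  simp only [velocity_eq]
  exact (((continuous_matrixCLM n n).comp_continuousOn (hA.comp hf hm)).clm_apply
    continuous_snd.continuousOn).add
    (((continuous_matrixCLM n m).comp_continuousOn (hB.comp hf hm)).clm_apply hu.continuousOn)

theorem locallyLipschitz_velocity (hA : ContinuousOn A (Icc 0 1)) (hB : ContinuousOn B (Icc 0 1))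
    (hu : IsFeedbackLaw u) (R : ℝ) :
    ∃ K : ℝ≥0, ∀ t ∈ Icc (0 : ℝ) 1, LipschitzOnWith K (velocity A B u t) (closedBall 0 R) := by
  obtain ⟨a, ha⟩ := exists_norm_matrixCLM_le hA
  obtain ⟨b, hb⟩ := exists_norm_matrixCLM_le hB
  obtain ⟨K, hK⟩ := hu.locallyLipschitz R
  refine ⟨a + b * K, fun t ht => ?_⟩
  have h1 : LipschitzWith a (matrixCLM n n (A t)) :=
    ContinuousLinearMap.lipschitzWith_of_opNorm_le (ha t ht)
  have h2 : LipschitzWith b (matrixCLM n m (B t)) :=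
    ContinuousLinearMap.lipschitzWith_of_opNorm_le (hb t ht)
  have e : velocity A B u t
      = fun x => matrixCLM n n (A t) x + matrixCLM n m (B t) (u t x) := by
    ext1 x; exact velocity_eq A B u t x
  rw [e]
  exact h1.lipschitzOnWith.add (h2.comp_lipschitzOnWith (hK t ht))

/-- The relative speed of the closed loop is controlled by the running cost. -/
theorem exists_relSpeed_velocity_le (hA : ContinuousOn A (Icc 0 1))
    (hB : ContinuousOn B (Icc 0 1)) (u : ℝ → Vec n → Vec m) :
    ∃ C : ℝ≥0, ∀ t ∈ Icc (0 : ℝ) 1, ∀ x,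
      relSpeed x (velocity A B u t x) ≤ C * (1 + 1 / 2 * ‖u t x‖ ^ 2) := by
  obtain ⟨a, ha⟩ := exists_norm_matrixCLM_le hA
  obtain ⟨b, hb⟩ := exists_norm_matrixCLM_le hB
  refine ⟨a + b, fun t ht x => ?_⟩
  have hs : 0 < √(1 + ‖x‖ ^ 2) := Real.sqrt_pos.2 (by positivity)
  have h1 : ‖x‖ ≤ √(1 + ‖x‖ ^ 2) := Real.le_sqrt_of_sq_le (by linarith)
  have h1' : 1 ≤ √(1 + ‖x‖ ^ 2) := Real.le_sqrt_of_sq_le (by simp)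
  have h2 : ‖u t x‖ ≤ 1 + 1 / 2 * ‖u t x‖ ^ 2 := by nlinarith [sq_nonneg (‖u t x‖ - 1)]
  have h3 : ‖velocity A B u t x‖ ≤ a * ‖x‖ + b * ‖u t x‖ := by
    rw [velocity_eq]
    exact (norm_add_le _ _).trans (add_le_add
      (ContinuousLinearMap.le_of_opNorm_le _ (ha t ht) x)
      (ContinuousLinearMap.le_of_opNorm_le _ (hb t ht) _))
  rw [relSpeed, div_le_iff₀ hs]
  refine h3.trans ?_
  generalize √(1 + ‖x‖ ^ 2) = σ at *
  generalize hc : 1 + 1 / 2 * ‖u t x‖ ^ 2 = c at *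
  have hc1 : 1 ≤ c := by rw [← hc]; simp
  have e1 : ‖x‖ ≤ c * σ := h1.trans (le_mul_of_one_le_left hs.le hc1)
  have e2 : ‖u t x‖ ≤ c * σ := h2.trans (le_mul_of_one_le_right (by linarith) h1')
  calc (a : ℝ) * ‖x‖ + b * ‖u t x‖ ≤ a * (c * σ) + b * (c * σ) := by gcongr
    _ = (a + b : ℝ≥0) * c * σ := by rw [NNReal.coe_add]; ring

end Velocity

/-! ### The continuity equation tested against backward transport -/

section MeasureSolution

variable {E : Type*} [NormedAddCommGroup E] [MeasurableSpace E]

/-- The total relative speed `∫₀¹ ∫ ‖V‖ / √(1 + ‖x‖²) dμₛ ds` of a transported curve of measures. -/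
def totalRelSpeed (μ : ℝ → Measure E) (V : ℝ → E → E) : ℝ≥0∞ :=
  ∫⁻ s in Icc (0 : ℝ) 1, ∫⁻ x, ENNReal.ofReal (relSpeed x (V s x)) ∂μ s

/-- No measurability of `G`, or of its inner integral in time, is needed: a Bochner integral is
always bounded by the `lintegral` of the norm. -/
theorem abs_iteratedIntegral_le {μ : ℝ → Measure E}
    (hμp : ∀ t ∈ Icc (0 : ℝ) 1, IsProbabilityMeasure (μ t)) {V : ℝ → E → E}
    (hV : totalRelSpeed μ V ≠ ⊤) {G : ℝ → E → ℝ} {a b : ℝ} (ha : 0 ≤ a) (hb : 0 ≤ b)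
    (hG : ∀ s ∈ Icc (0 : ℝ) 1, ∀ x, |G s x| ≤ a + b * relSpeed x (V s x)) {t : ℝ}
    (ht : t ∈ Icc (0 : ℝ) 1) :
    |∫ s in (0 : ℝ)..t, ∫ x, G s x ∂μ s| ≤ a + b * (totalRelSpeed μ V).toReal := by
  have hin : ∀ s ∈ Icc (0 : ℝ) 1, ‖∫ x, G s x ∂μ s‖ₑ ≤ ENNReal.ofReal a
      + ENNReal.ofReal b * ∫⁻ x, ENNReal.ofReal (relSpeed x (V s x)) ∂μ s := by
    intro s hs
    have := hμp s hs
    calc ‖∫ x, G s x ∂μ s‖ₑ ≤ ∫⁻ x, ‖G s x‖ₑ ∂μ s := enorm_integral_le_lintegral_enorm _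
      _ ≤ ∫⁻ x, (ENNReal.ofReal a
          + ENNReal.ofReal b * ENNReal.ofReal (relSpeed x (V s x))) ∂μ s := by
          refine lintegral_mono fun x => ?_
          rw [← ENNReal.ofReal_mul hb,
            ← ENNReal.ofReal_add ha (mul_nonneg hb (relSpeed_nonneg _ _)), Real.enorm_eq_ofReal_abs]
          exact ENNReal.ofReal_le_ofReal (hG s hs x)
      _ = _ := by
          rw [lintegral_add_left measurable_const, lintegral_const_mul' _ _ ENNReal.ofReal_ne_top]
          simp
  have hsub : Ioc 0 t ⊆ Icc (0 : ℝ) 1 := fun s hs => ⟨hs.1.le, hs.2.trans ht.2⟩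
  have htot : ‖∫ s in (0 : ℝ)..t, ∫ x, G s x ∂μ s‖ₑ
      ≤ ENNReal.ofReal a + ENNReal.ofReal b * totalRelSpeed μ V := by
    rw [intervalIntegral.integral_of_le ht.1]
    calc _ ≤ ∫⁻ s in Ioc 0 t, ‖∫ x, G s x ∂μ s‖ₑ := enorm_integral_le_lintegral_enorm _
      _ ≤ ∫⁻ s in Ioc 0 t, (ENNReal.ofReal a
          + ENNReal.ofReal b * ∫⁻ x, ENNReal.ofReal (relSpeed x (V s x)) ∂μ s) :=
          setLIntegral_mono' measurableSet_Ioc fun s hs => hin s (hsub hs)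
      _ ≤ ∫⁻ s in Icc (0 : ℝ) 1, (ENNReal.ofReal a
          + ENNReal.ofReal b * ∫⁻ x, ENNReal.ofReal (relSpeed x (V s x)) ∂μ s) :=
          lintegral_mono_set hsub
      _ = _ := by
          rw [lintegral_add_left measurable_const, lintegral_const_mul' _ _ ENNReal.ofReal_ne_top]
          simp [totalRelSpeed]
  have h1 := ENNReal.toReal_mono (by finiteness) htot
  rwa [toReal_enorm, Real.norm_eq_abs, ENNReal.toReal_add (by finiteness) (by finiteness),
    ENNReal.toReal_mul, ENNReal.toReal_ofReal ha, ENNReal.toReal_ofReal hb] at h1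

variable [InnerProductSpace ℝ E]

/-- The weak continuity equation for a curve of measures `μ`, transported by the velocity `V`. -/
def IsMeasureSolution (μ : ℝ → Measure E) (V : ℝ → E → E) : Prop :=
  ∀ φ : ℝ × E → ℝ, ContDiff ℝ ((⊤ : ℕ∞) : WithTop ℕ∞) φ → HasCompactSupport φ →
    ∀ t ∈ Icc (0 : ℝ) 1,
      (∫ x, φ (t, x) ∂μ t) - ∫ x, φ (0, x) ∂μ 0
        = ∫ s in (0 : ℝ)..t, ∫ x, fderiv ℝ φ (s, x) (1, V s x) ∂μ s

variable [BorelSpace E] [FiniteDimensional ℝ E]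

/-- Testing the continuity equation against a mollified backward transport, cut off at logarithmic
scale `k`: up to an error `O(1 / k)`, the flow of a tame field that agrees with `V` where
`logSize ≤ 2k` transports `χ μ₀` into `μₜ`. -/
theorem IsMeasureSolution.exists_cutoff_integral_flow_le {μ : ℝ → Measure E} {V : ℝ → E → E}
    (hμ : IsMeasureSolution μ V) (hμp : ∀ t ∈ Icc (0 : ℝ) 1, IsProbabilityMeasure (μ t))
    (hV : totalRelSpeed μ V ≠ ⊤) :
    ∃ C : ℝ, 0 ≤ C ∧ ∀ k : ℝ, 1 ≤ k → ∃ χ : E → ℝ, Continuous χ ∧ (∀ x, 0 ≤ χ x) ∧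
      (∀ x, χ x ≤ 1) ∧ (∀ x, logSize x ≤ k → χ x = 1) ∧
      ∀ (W : ℝ → E → E) (K M : ℝ≥0) (hW : IsTameField W K M),
        (∀ t ∈ Icc (0 : ℝ) 1, ∀ x, logSize x ≤ 2 * k → W t x = V t x) →
        ∀ (ψ : E → ℝ) (L : ℝ≥0), LipschitzWith L ψ → (∀ x, 0 ≤ ψ x) → (∀ x, ψ x ≤ 1) →
          ∀ t ∈ Icc (0 : ℝ) 1,
            ∫ x, χ x * ψ (hW.flow 0 x t) ∂μ 0 ≤ (∫ x, ψ x ∂μ t) + C / k := by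
  obtain ⟨C, hC, hcut⟩ := exists_log_cutoff E
  refine ⟨2 * C * (totalRelSpeed μ V).toReal, by positivity, fun k hk => ?_⟩
  have hk0 : 0 < k := by linarith
  obtain ⟨χ, hχs, hχc, hχ0, hχ1, hχone, hχzero, hχd⟩ := hcut k hk
  refine ⟨χ, hχs.continuous, hχ0, hχ1, hχone, fun W K M hW hWV ψ L hψ hψ0 hψ1 t ht => ?_⟩
  refine le_of_forall_pos_le_add fun e he => ?_
  set δ : ℝ := min 1 (e / 3) with hδ
  have hδ0 : 0 < δ := by positivity
  have hδ1 : δ ≤ 1 := min_le_left _ _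
  have hδe : 3 * δ ≤ e := by have := min_le_right 1 (e / 3); linarith
  obtain ⟨g, hgs, hgb, hgψ, hgd⟩ := hW.exists_smooth_transport hψ
    (fun x => by rw [abs_of_nonneg (hψ0 x)]; exact hψ1 x) ht hδ0
  have h0I : (0 : ℝ) ∈ Icc (0 : ℝ) 1 := ⟨le_rfl, zero_le_one⟩
  have hJ : Icc (0 : ℝ) 1 ⊆ Icc (-1 : ℝ) 2 := Icc_subset_Icc (by norm_num) (by norm_num)
  have hp0 := hμp 0 h0I
  have hpt := hμp t ht
  -- a cutoff in time, equal to `1` around `[0, 1]`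
  let θ : ContDiffBump (0 : ℝ) := ⟨2, 3, by norm_num, by norm_num⟩
  have hθ : ∀ s ∈ ball (0 : ℝ) 2, θ s = 1 := fun s hs =>
    θ.one_of_mem_closedBall (ball_subset_closedBall hs)
  have hIb : ∀ s ∈ Icc (0 : ℝ) 1, s ∈ ball (0 : ℝ) 2 := fun s hs => by
    rw [mem_ball, Real.dist_eq, sub_zero, abs_of_nonneg hs.1]; linarith [hs.2]
  let φ : ℝ × E → ℝ := fun p => θ p.1 * (g p * χ p.2)
  have hφs : ContDiff ℝ ((⊤ : ℕ∞) : WithTop ℕ∞) φ :=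
    (θ.contDiff.comp contDiff_fst).mul (hgs.mul (hχs.comp contDiff_snd))
  have hφc : HasCompactSupport φ := by
    refine HasCompactSupport.intro ((isCompact_closedBall (0 : ℝ) 3).prod hχc.isCompact) ?_
    rintro ⟨s, x⟩ hp
    rw [mem_prod, not_and_or] at hp
    rcases hp with hp | hp
    · have : θ s = 0 := θ.zero_of_le_dist (not_le.1 hp).le
      simp [φ, this]
    · have : χ x = 0 := image_eq_zero_of_notMem_tsupport hp
      simp [φ, this]
  have hφI : ∀ s ∈ Icc (0 : ℝ) 1, ∀ x, φ (s, x) = g (s, x) * χ x := fun s hs x => by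
    simp [φ, hθ s (hIb s hs)]
  have hφd : ∀ s ∈ Icc (0 : ℝ) 1, ∀ x v, fderiv ℝ φ (s, x) (1, v)
      = g (s, x) * fderiv ℝ χ x v + χ x * fderiv ℝ g (s, x) (1, v) := by
    intro s hs x v
    have h1 : φ =ᶠ[𝓝 (s, x)] fun p => g p * χ p.2 := by
      have : ∀ᶠ p : ℝ × E in 𝓝 (s, x), p.1 ∈ ball (0 : ℝ) 2 :=
        continuous_fst.continuousAt (isOpen_ball.mem_nhds (hIb s hs))
      filter_upwards [this] with p hp
      simp [φ, hθ p.1 hp]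
    have h2 : HasFDerivAt g (fderiv ℝ g (s, x)) (s, x) :=
      (hgs.differentiable (by simp) _).hasFDerivAt
    have h3 : HasFDerivAt (fun p : ℝ × E => χ p.2)
        ((fderiv ℝ χ x).comp (ContinuousLinearMap.snd ℝ ℝ E)) (s, x) :=
      HasFDerivAt.comp (s, x) (f := Prod.snd) (hχs.differentiable (by simp) x).hasFDerivAt
        hasFDerivAt_snd
    rw [h1.fderiv_eq, (h2.fun_mul h3).fderiv]
    simp
  have hG : ∀ s ∈ Icc (0 : ℝ) 1, ∀ x, |fderiv ℝ φ (s, x) (1, V s x)|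
      ≤ δ + 2 * C / k * relSpeed x (V s x) := by
    intro s hs x
    have hr := relSpeed_nonneg x (V s x)
    rw [hφd s hs]
    -- `V` is `W` on the support of `χ`, so the derivative of `g` only enters along `(1, W)`
    by_cases hx : logSize x ≤ 2 * k
    · have h1 : |χ x * fderiv ℝ g (s, x) (1, V s x)| ≤ 1 * δ := by
        rw [abs_mul, abs_of_nonneg (hχ0 x), ← hWV s hs x hx]
        exact mul_le_mul (hχ1 x) (hgd s hs x) (abs_nonneg _) zero_le_one
      have h2 : |g (s, x) * fderiv ℝ χ x (V s x)| ≤ 2 * (C / k * relSpeed x (V s x)) := by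
        rw [abs_mul]
        exact mul_le_mul ((hgb _).trans (by linarith)) (hχd x _) (abs_nonneg _) zero_le_two
      calc _ ≤ _ := abs_add_le _ _
        _ ≤ 2 * (C / k * relSpeed x (V s x)) + 1 * δ := add_le_add h2 h1
        _ = _ := by ring
    · obtain ⟨h1, h2⟩ := hχzero x (not_le.1 hx)
      rw [h1, h2]
      simp only [_root_.zero_apply, mul_zero, zero_mul, add_zero, abs_zero]
      positivity
  have hR := abs_iteratedIntegral_le hμp hV hδ0.le (by positivity) hG ht
  have hw := hμ φ hφs hφc t ht
  simp only [hφI t ht, hφI 0 h0I] at hw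
  rw [← hw] at hR
  -- every function below is continuous and bounded, hence integrable
  have bint : ∀ {ν : Measure E} [IsProbabilityMeasure ν] {f : E → ℝ}, Continuous f →
      (∀ x, |f x| ≤ 2) → Integrable f ν := fun {ν} _ {f} hf hb =>
    Integrable.of_bound hf.aestronglyMeasurable 2 (Eventually.of_forall hb)
  have hgχ : ∀ s x, |g (s, x) * χ x| ≤ 2 := fun s x => by
    rw [abs_mul, abs_of_nonneg (hχ0 x)]
    calc _ ≤ 2 * 1 := mul_le_mul ((hgb _).trans (by linarith)) (hχ1 x) (hχ0 x) zero_le_two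
      _ = 2 := by norm_num
  have hgχc : ∀ s, Continuous fun x => g (s, x) * χ x := fun s =>
    (hgs.continuous.comp (Continuous.prodMk_right s)).mul hχs.continuous
  have hflow : Continuous fun x => hW.flow 0 x t :=
    hW.continuous_flow_right (hJ h0I) (hJ ht)
  have i0 : ∫ x, χ x * ψ (hW.flow 0 x t) ∂μ 0 ≤ (∫ x, g (0, x) * χ x ∂μ 0) + δ := by
    rw [← sub_le_iff_le_add', ← integral_sub]
    · calc _ ≤ ∫ _x, δ ∂μ 0 := by
            refine integral_mono (.sub (bint ?_ ?_) (bint (hgχc 0) (hgχ 0))) (integrable_const _)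
              fun x => ?_
            · exact hχs.continuous.mul (hψ.continuous.comp hflow)
            · intro x
              rw [abs_of_nonneg (mul_nonneg (hχ0 _) (hψ0 _))]
              nlinarith [hχ0 x, hχ1 x, hψ0 (hW.flow 0 x t), hψ1 (hW.flow 0 x t)]
            · have := abs_le.1 (hgψ 0 h0I x)
              change χ x * ψ (hW.flow 0 x t) - g (0, x) * χ x ≤ δ
              nlinarith [hχ0 x, hχ1 x]
        _ = δ := by simp
    · refine bint (hχs.continuous.mul (hψ.continuous.comp hflow)) fun x => ?_
      rw [abs_of_nonneg (mul_nonneg (hχ0 _) (hψ0 _))]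
      nlinarith [hχ0 x, hχ1 x, hψ0 (hW.flow 0 x t), hψ1 (hW.flow 0 x t)]
    · exact bint (hgχc 0) (hgχ 0)
  have it : ∫ x, g (t, x) * χ x ∂μ t ≤ (∫ x, ψ x ∂μ t) + δ := by
    have hψi : Integrable ψ (μ t) := bint hψ.continuous fun x => by
      rw [abs_of_nonneg (hψ0 x)]; linarith [hψ1 x]
    rw [← sub_le_iff_le_add', ← integral_sub (bint (hgχc t) (hgχ t)) hψi]
    calc _ ≤ ∫ _x, δ ∂μ t := by
          refine integral_mono (.sub (bint (hgχc t) (hgχ t)) hψi) (integrable_const _) fun x => ?_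
          have := abs_le.1 (hgψ t ht x)
          rw [hW.flow_self (hJ ht)] at this
          change g (t, x) * χ x - ψ x ≤ δ
          nlinarith [hχ0 x, hχ1 x, hψ0 x]
      _ = δ := by simp
  have hR' := (abs_le.1 hR).1
  have e1 : 2 * C * (totalRelSpeed μ V).toReal / k
      = 2 * C / k * (totalRelSpeed μ V).toReal := by ring
  rw [e1]
  linarith

end MeasureSolution

/-! ### Trajectories that stay in a logarithmic ball -/

section Exhaustion

theorem zero_mem_Icc : (0 : ℝ) ∈ Icc (0 : ℝ) 1 := ⟨le_rfl, zero_le_one⟩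

theorem Icc_zero_one_subset : Icc (0 : ℝ) 1 ⊆ Icc (-1 : ℝ) 2 :=
  Icc_subset_Icc (by norm_num) (by norm_num)

variable {E : Type*} [NormedAddCommGroup E] [InnerProductSpace ℝ E] [FiniteDimensional ℝ E]
  {V : ℝ → E → E} {W : ℕ → ℝ → E → E} {K M : ℕ → ℝ≥0}

/-- The initial states whose trajectory under the `k`-th field keeps `logSize ≤ k` up to time `t`.
If the `k`-th field agrees with `V` where `logSize ≤ 2k`, these are trajectories of `V`. -/
def staySet (hW : ∀ k, IsTameField (W k) (K k) (M k)) (k : ℕ) (t : ℝ) : Set E :=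
  {x | ∀ s ∈ Icc (0 : ℝ) t, logSize ((hW k).flow 0 x s) ≤ k}

theorem IsTameField.continuous_flow_projIcc {W : ℝ → E → E} {K M : ℝ≥0} (hW : IsTameField W K M) :
    Continuous fun p : E × ℝ => hW.flow 0 p.1 (projIcc (0 : ℝ) 1 zero_le_one p.2) := by
  have h0 := Icc_zero_one_subset zero_mem_Icc
  refine continuous_prod_of_continuous_lipschitzWith _ ⟨Real.exp (K * 3), (Real.exp_pos _).le⟩
    (fun x => ?_) fun s => LipschitzWith.of_dist_le_mul fun x y =>
      hW.dist_flow_flow_le h0 (Icc_zero_one_subset (projIcc (0 : ℝ) 1 zero_le_one s).2) x y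
  exact ((hW.isIntegralCurveOn_flow h0 x).continuousOn).comp_continuous
    (continuous_subtype_val.comp continuous_projIcc)
    fun s => Icc_zero_one_subset (projIcc (0 : ℝ) 1 zero_le_one s).2

variable (hW : ∀ k, IsTameField (W k) (K k) (M k))

theorem staySet_anti (k : ℕ) {s t : ℝ} (h : s ≤ t) : staySet hW k t ⊆ staySet hW k s :=
  fun _ hx r hr => hx r ⟨hr.1, hr.2.trans h⟩

theorem logSize_le_of_mem_staySet {k : ℕ} {t : ℝ} (ht : 0 ≤ t) {x : E} (hx : x ∈ staySet hW k t) :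
    logSize x ≤ k := by
  have := hx 0 ⟨le_rfl, ht⟩
  rwa [(hW k).flow_self (Icc_zero_one_subset zero_mem_Icc)] at this

theorem isClosed_setOf_mem_staySet (k : ℕ) :
    IsClosed {p : E × ℝ | p.2 ∈ Icc (0 : ℝ) 1 ∧ p.1 ∈ staySet hW k p.2} := by
  -- rescaling time makes the range of the universal quantifier independent of the point
  have : {p : E × ℝ | p.2 ∈ Icc (0 : ℝ) 1 ∧ p.1 ∈ staySet hW k p.2}
      = {p : E × ℝ | p.2 ∈ Icc (0 : ℝ) 1} ∩ ⋂ l ∈ Icc (0 : ℝ) 1, {p : E × ℝ |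
        logSize ((hW k).flow 0 p.1 (projIcc (0 : ℝ) 1 zero_le_one (l * p.2))) ≤ k} := by
    ext ⟨x, s⟩
    simp only [mem_ofPred_eq, mem_inter_iff, mem_iInter]
    refine and_congr_right fun hs => ⟨fun hx l hl => ?_, fun hx r hr => ?_⟩
    · have hm : l * s ∈ Icc (0 : ℝ) 1 :=
        ⟨mul_nonneg hl.1 hs.1, mul_le_one₀ hl.2 hs.1 hs.2⟩
      rw [projIcc_of_mem zero_le_one hm]
      exact hx _ ⟨hm.1, mul_le_of_le_one_left hs.1 hl.2⟩
    · rcases hr.1.eq_or_lt with h0 | h0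
      · have := hx 0 ⟨le_rfl, zero_le_one⟩
        rw [zero_mul, projIcc_of_mem zero_le_one zero_mem_Icc] at this
        rwa [← h0]
      · have hs0 : 0 < s := h0.trans_le hr.2
        have := hx (r / s) ⟨by positivity, (div_le_one hs0).2 hr.2⟩
        rwa [div_mul_cancel₀ _ hs0.ne',
          projIcc_of_mem zero_le_one ⟨hr.1, hr.2.trans hs.2⟩] at this
  rw [this]
  refine (isClosed_Icc.preimage continuous_snd).inter (isClosed_biInter fun l _ => ?_)
  exact isClosed_le (continuous_logSize.comp ((hW k).continuous_flow_projIcc.comp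
    (continuous_fst.prodMk (continuous_const.mul continuous_snd)))) continuous_const

theorem isClosed_staySet (k : ℕ) {t : ℝ} (ht : t ∈ Icc (0 : ℝ) 1) : IsClosed (staySet hW k t) := by
  have := (isClosed_setOf_mem_staySet hW k).preimage (Continuous.prodMk_left (X := E) t)
  convert this using 1
  ext x
  simp only [mem_preimage, mem_ofPred_eq, ht, true_and]

variable {hW} (hWV : ∀ k : ℕ, ∀ t ∈ Icc (0 : ℝ) 1, ∀ x, logSize x ≤ 2 * k → W k t x = V t x)
include hWV

theorem isIntegralCurveOn_of_mem_staySet {k : ℕ} {t : ℝ} (ht : t ∈ Icc (0 : ℝ) 1) {x : E}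
    (hx : x ∈ staySet hW k t) : IsIntegralCurveOn ((hW k).flow 0 x) V (Icc 0 t) := by
  intro s hs
  have hsI : s ∈ Icc (0 : ℝ) 1 := ⟨hs.1, hs.2.trans ht.2⟩
  have hk : (0 : ℝ) ≤ k := Nat.cast_nonneg k
  rw [← hWV k s hsI _ ((hx s hs).trans (by linarith))]
  exact (((hW k).isIntegralCurveOn_flow (Icc_zero_one_subset zero_mem_Icc) x).mono
    ((Icc_subset_Icc_right ht.2).trans Icc_zero_one_subset)) s hs

theorem flow_eq_of_mem_staySet {k j : ℕ} (hkj : k ≤ j) {t : ℝ} (ht : t ∈ Icc (0 : ℝ) 1) {x : E}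
    (hx : x ∈ staySet hW k t) {s : ℝ} (hs : s ∈ Icc 0 t) :
    (hW j).flow 0 x s = (hW k).flow 0 x s := by
  have hkj' : (k : ℝ) ≤ j := Nat.cast_le.2 hkj
  have hk : (0 : ℝ) ≤ k := Nat.cast_nonneg k
  have hy : IsIntegralCurveOn ((hW k).flow 0 x) (W j) (Icc 0 t) := fun r hr => by
    rw [hWV j r ⟨hr.1, hr.2.trans ht.2⟩ _ ((hx r hr).trans (by linarith))]
    exact isIntegralCurveOn_of_mem_staySet hWV ht hx r hr
  have := (hW j).eq_flow ((Icc_subset_Icc_right ht.2).trans Icc_zero_one_subset) hy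
    (s := 0) ⟨le_rfl, ht.1⟩ hs
  rwa [(hW k).flow_self (Icc_zero_one_subset zero_mem_Icc), eq_comm] at this

theorem staySet_mono {k j : ℕ} (hkj : k ≤ j) {t : ℝ} (ht : t ∈ Icc (0 : ℝ) 1) :
    staySet hW k t ⊆ staySet hW j t := fun x hx s hs => by
  rw [flow_eq_of_mem_staySet hWV hkj ht hx hs]
  exact (hx s hs).trans (Nat.cast_le.2 hkj)

variable [MeasurableSpace E] [BorelSpace E] {μ : ℝ → Measure E}

/-- The limit of the cutoff estimate as the scale of the cutoff tends to infinity: on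
`staySet hW k t` the cutoffs are eventually `1` and the truncated flows eventually agree. -/
theorem setIntegral_staySet_le (hμ : IsMeasureSolution μ V)
    (hμp : ∀ t ∈ Icc (0 : ℝ) 1, IsProbabilityMeasure (μ t)) (hV : totalRelSpeed μ V ≠ ⊤)
    (k : ℕ) {t : ℝ} (ht : t ∈ Icc (0 : ℝ) 1) {ψ : E → ℝ} {L : ℝ≥0} (hψ : LipschitzWith L ψ)
    (hψ0 : ∀ x, 0 ≤ ψ x) (hψ1 : ∀ x, ψ x ≤ 1) :
    ∫ x in staySet hW k t, ψ ((hW k).flow 0 x t) ∂μ 0 ≤ ∫ x, ψ x ∂μ t := by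
  obtain ⟨C, hC, h⟩ := hμ.exists_cutoff_integral_flow_le hμp hV
  have hp0 := hμp 0 zero_mem_Icc
  have hlim : Tendsto (fun j : ℕ => (∫ x, ψ x ∂μ t) + C / j) atTop (𝓝 ((∫ x, ψ x ∂μ t) + 0)) :=
    tendsto_const_nhds.add (tendsto_const_div_atTop_nhds_zero_nat C)
  rw [add_zero] at hlim
  refine ge_of_tendsto hlim ?_
  filter_upwards [eventually_ge_atTop (max k 1)] with j hj
  have hkj : k ≤ j := (le_max_left _ _).trans hj
  obtain ⟨χ, hχc, hχ0, hχ1, hχone, hmain⟩ := h j (by exact_mod_cast (le_max_right k 1).trans hj)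
  refine le_trans ?_ (hmain (W j) (K j) (M j) (hW j) (hWV j) ψ L hψ hψ0 hψ1 t ht)
  have hm := (isClosed_staySet hW k ht).measurableSet
  have hcont : Continuous fun x => χ x * ψ ((hW j).flow 0 x t) :=
    hχc.mul (hψ.continuous.comp ((hW j).continuous_flow_right
      (Icc_zero_one_subset zero_mem_Icc) (Icc_zero_one_subset ht)))
  have hnn : ∀ x, 0 ≤ χ x * ψ ((hW j).flow 0 x t) := fun x => mul_nonneg (hχ0 x) (hψ0 _)
  have hint : Integrable (fun x => χ x * ψ ((hW j).flow 0 x t)) (μ 0) :=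
    Integrable.of_bound hcont.aestronglyMeasurable 1 (Eventually.of_forall fun x => by
      rw [Real.norm_of_nonneg (hnn x)]
      exact mul_le_one₀ (hχ1 x) (hψ0 _) (hψ1 _))
  calc ∫ x in staySet hW k t, ψ ((hW k).flow 0 x t) ∂μ 0
      = ∫ x in staySet hW k t, χ x * ψ ((hW j).flow 0 x t) ∂μ 0 := by
        refine setIntegral_congr_fun hm fun x hx => ?_
        have hk : logSize x ≤ j :=
          (logSize_le_of_mem_staySet hW ht.1 hx).trans (Nat.cast_le.2 hkj)
        simp only [hχone x hk, one_mul, flow_eq_of_mem_staySet hWV hkj ht hx ⟨ht.1, le_rfl⟩]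
    _ ≤ _ := setIntegral_le_integral hint (Eventually.of_forall hnn)

/-- The flow carries the part of `μ₀` that stays where the flow is known into `μₜ`. -/
theorem map_restrict_staySet_le (hμ : IsMeasureSolution μ V)
    (hμp : ∀ t ∈ Icc (0 : ℝ) 1, IsProbabilityMeasure (μ t)) (hV : totalRelSpeed μ V ≠ ⊤)
    (k : ℕ) {t : ℝ} (ht : t ∈ Icc (0 : ℝ) 1) :
    ((μ 0).restrict (staySet hW k t)).map (fun x => (hW k).flow 0 x t) ≤ μ t := by
  have hp0 := hμp 0 zero_mem_Icc
  have hpt := hμp t ht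
  have hfc : Continuous fun x => (hW k).flow 0 x t := (hW k).continuous_flow_right
      (Icc_zero_one_subset zero_mem_Icc) (Icc_zero_one_subset ht)
  set ν := ((μ 0).restrict (staySet hW k t)).map (fun x => (hW k).flow 0 x t) with hν
  have hclosed : ∀ F : Set E, IsClosed F → ν F ≤ μ t F := by
    intro F hF
    have hδ : ∀ n : ℕ, (0 : ℝ) < 1 / (n + 1) := fun n => Nat.one_div_pos_of_nat
    have l1 := tendsto_integral_thickenedIndicator_of_isClosed ν hF hδ
      tendsto_one_div_add_atTop_nhds_zero_nat
    have l2 := tendsto_integral_thickenedIndicator_of_isClosed (μ t) hF hδ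
      tendsto_one_div_add_atTop_nhds_zero_nat
    have hle : ν.real F ≤ (μ t).real F := by
      refine le_of_tendsto_of_tendsto' l1 l2 fun n => ?_
      rw [hν, integral_map hfc.aemeasurable
        (f := fun x => (thickenedIndicator (hδ n) F x : ℝ))
        (NNReal.continuous_coe.comp (thickenedIndicator (hδ n) F).continuous).aestronglyMeasurable]
      exact setIntegral_staySet_le hWV hμ hμp hV k ht
        (ψ := fun x => (thickenedIndicator (hδ n) F x : ℝ))
        ((LipschitzWith.subtype_val _).comp (lipschitzWith_thickenedIndicator (hδ n) F))
        (fun x => NNReal.coe_nonneg _)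
        (fun x => by exact_mod_cast thickenedIndicator_le_one (hδ n) F x)
    exact (ENNReal.toReal_le_toReal (by finiteness) (by finiteness)).1 hle
  refine Measure.le_iff.2 fun S hS => ?_
  rw [hS.measure_eq_iSup_isClosed_of_ne_top (measure_ne_top ν S)]
  exact iSup₂_le fun F hFS => iSup_le fun hF => (hclosed F hF).trans (measure_mono hFS)

end Exhaustion

/-! ### Absence of explosion and the flow representation -/

section NonExplosion

theorem measurable_relSpeed {E : Type*} [NormedAddCommGroup E] [MeasurableSpace E]
    [BorelSpace E] : Measurable fun p : E × E => relSpeed p.1 p.2 := by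
  unfold relSpeed
  fun_prop

variable {E : Type*} [NormedAddCommGroup E] [InnerProductSpace ℝ E] [FiniteDimensional ℝ E]
  {V : ℝ → E → E} {W : ℕ → ℝ → E → E} {K M : ℕ → ℝ≥0}
  {hW : ∀ k, IsTameField (W k) (K k) (M k)}

/-- The relative speed accumulated by a trajectory on `[0, 1]` before `logSize` exceeds `k`. -/
def stayRelSpeed (hW : ∀ k, IsTameField (W k) (K k) (M k)) (V : ℝ → E → E) (k : ℕ) (x : E) :
    ℝ≥0∞ :=
  ∫⁻ s in Icc (0 : ℝ) 1, (staySet hW k s).indicator (fun x =>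
    ENNReal.ofReal (relSpeed ((hW k).flow 0 x s) (V s ((hW k).flow 0 x s)))) x

/-- A trajectory can only leave `logSize ≤ k` at the expense of relative speed. -/
theorem ofReal_sub_le_stayRelSpeed
    (hWV : ∀ k : ℕ, ∀ t ∈ Icc (0 : ℝ) 1, ∀ x, logSize x ≤ 2 * k → W k t x = V t x)
    {k : ℕ} {r : ℝ} {x : E} (hxr : logSize x ≤ r) (hx : x ∉ staySet hW k 1) :
    ENNReal.ofReal (k - r) ≤ stayRelSpeed hW V k x := by
  have h0J := Icc_zero_one_subset zero_mem_Icc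
  have hk0 : (0 : ℝ) ≤ k := Nat.cast_nonneg k
  set y := (hW k).flow 0 x with hy
  have hyJ : IsIntegralCurveOn y (W k) (Icc (-1) 2) := (hW k).isIntegralCurveOn_flow h0J x
  have hyc : ContinuousOn y (Icc 0 1) := hyJ.continuousOn.mono Icc_zero_one_subset
  -- the first time at which `logSize` reaches `k`
  set T : Set ℝ := Icc (0 : ℝ) 1 ∩ (fun s => logSize (y s)) ⁻¹' Ici (k : ℝ) with hT
  have hTc : IsClosed T :=
    (continuous_logSize.comp_continuousOn hyc).preimage_isClosed_of_isClosed isClosed_Icc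
      isClosed_Ici
  have hTne : T.Nonempty := by
    simp only [staySet, mem_ofPred_eq, not_forall, not_le] at hx
    obtain ⟨s, hs, h⟩ := hx
    exact ⟨s, hs, h.le⟩
  have hTb : BddBelow T := ⟨0, fun s hs => hs.1.1⟩
  set τ := sInf T
  have hτ : τ ∈ T := hTc.csInf_mem hTne hTb
  have hlt : ∀ s ∈ Ico 0 τ, logSize (y s) < k := fun s hs => by
    by_contra h
    exact (csInf_le hTb ⟨⟨hs.1, hs.2.le.trans hτ.1.2⟩, not_lt.1 h⟩).not_gt hs.2
  have hsub : Icc 0 τ ⊆ Icc (0 : ℝ) 1 := Icc_subset_Icc_right hτ.1.2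
  have hWc : Continuous fun p : ℝ × E => W k p.1 p.2 := (hW k).uniformContinuous.continuous
  set d : ℝ → ℝ := fun s => fderiv ℝ logSize (y s) (W k s (y s)) with hd
  have hdc : ContinuousOn d (Icc 0 τ) := by
    have h1 : ContinuousOn (fun s => fderiv ℝ logSize (y s)) (Icc 0 τ) :=
      (contDiff_logSize.continuous_fderiv (by simp)).comp_continuousOn (hyc.mono hsub)
    exact h1.clm_apply (hWc.comp_continuousOn (continuousOn_id.prodMk (hyc.mono hsub)))
  have hFTC : ∫ s in (0 : ℝ)..τ, d s = logSize (y τ) - logSize (y 0) := by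
    refine intervalIntegral.integral_eq_sub_of_hasDerivAt_of_le hτ.1.1
      (continuous_logSize.comp_continuousOn (hyc.mono hsub)) (fun s hs => ?_)
      (hdc.intervalIntegrable_of_Icc hτ.1.1)
    have h1 : HasDerivAt y (W k s (y s)) s :=
      (hyJ s (Icc_zero_one_subset (hsub (Ioo_subset_Icc_self hs)))).hasDerivAt
        (Icc_mem_nhds (by linarith [hs.1]) (by linarith [hs.2, hτ.1.2]))
    exact (hasFDerivAt_logSize (y s)).differentiableAt.hasFDerivAt.comp_hasDerivAt s h1
  have hle : (k : ℝ) - r ≤ ∫ s in (0 : ℝ)..τ, d s := by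
    rw [hFTC, hy, (hW k).flow_self h0J]
    have : (k : ℝ) ≤ logSize (y τ) := hτ.2
    linarith
  calc ENNReal.ofReal (k - r) ≤ ENNReal.ofReal ‖∫ s in (0 : ℝ)..τ, d s‖ :=
        ENNReal.ofReal_le_ofReal (hle.trans (le_abs_self _))
    _ = ‖∫ s in Ioo (0 : ℝ) τ, d s‖ₑ := by
        rw [ofReal_norm, intervalIntegral.integral_of_le hτ.1.1,
          integral_Ioc_eq_integral_Ioo]
    _ ≤ ∫⁻ s in Ioo (0 : ℝ) τ, ‖d s‖ₑ := enorm_integral_le_lintegral_enorm _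
    _ ≤ ∫⁻ s in Ioo (0 : ℝ) τ, (staySet hW k s).indicator (fun x =>
          ENNReal.ofReal (relSpeed ((hW k).flow 0 x s) (V s ((hW k).flow 0 x s)))) x := by
        refine setLIntegral_mono' measurableSet_Ioo fun s hs => ?_
        have hxs : x ∈ staySet hW k s := fun q hq => (hlt q ⟨hq.1, hq.2.trans_lt hs.2⟩).le
        have hys := hlt s ⟨hs.1.le, hs.2⟩
        rw [indicator_of_mem hxs, Real.enorm_eq_ofReal_abs,
          ← hWV k s (hsub (Ioo_subset_Icc_self hs)) _ (by linarith)]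
        exact ENNReal.ofReal_le_ofReal (abs_fderiv_logSize_le _ _)
    _ ≤ stayRelSpeed hW V k x := lintegral_mono_set (Ioo_subset_Icc_self.trans hsub)

variable [MeasurableSpace E] [BorelSpace E] {μ : ℝ → Measure E}

/-- On average, a trajectory accumulates no more relative speed than the transported curve of
measures has in total. -/
theorem lintegral_stayRelSpeed_le
    (hWV : ∀ k : ℕ, ∀ t ∈ Icc (0 : ℝ) 1, ∀ x, logSize x ≤ 2 * k → W k t x = V t x)
    (hVc : ∀ t ∈ Icc (0 : ℝ) 1, Continuous (V t)) (hμ : IsMeasureSolution μ V)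
    (hμp : ∀ t ∈ Icc (0 : ℝ) 1, IsProbabilityMeasure (μ t)) (hV : totalRelSpeed μ V ≠ ⊤) (k : ℕ) :
    AEMeasurable (stayRelSpeed hW V k) (μ 0) ∧
      ∫⁻ x, stayRelSpeed hW V k x ∂μ 0 ≤ totalRelSpeed μ V := by
  have hp0 := hμp 0 zero_mem_Icc
  have hk0 : (0 : ℝ) ≤ k := Nat.cast_nonneg k
  let y : E → ℝ → E := fun x s => (hW k).flow 0 x (projIcc (0 : ℝ) 1 zero_le_one s)
  have hyc : Continuous fun p : E × ℝ => y p.1 p.2 := (hW k).continuous_flow_projIcc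
  let S : Set (E × ℝ) := {p | p.2 ∈ Icc (0 : ℝ) 1 ∧ p.1 ∈ staySet hW k p.2}
  have hS : MeasurableSet S := (isClosed_setOf_mem_staySet hW k).measurableSet
  let H : E × ℝ → ℝ≥0∞ := S.indicator fun p =>
    ENNReal.ofReal (relSpeed (y p.1 p.2) (W k p.2 (y p.1 p.2)))
  have hH : Measurable H := by
    refine Measurable.indicator ?_ hS
    refine (measurable_relSpeed.comp (hyc.measurable.prodMk ?_)).ennreal_ofReal
    exact ((hW k).uniformContinuous.continuous.comp (continuous_snd.prodMk hyc)).measurable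
  have hHeq : ∀ s ∈ Icc (0 : ℝ) 1, ∀ x, (staySet hW k s).indicator (fun x =>
      ENNReal.ofReal (relSpeed ((hW k).flow 0 x s) (V s ((hW k).flow 0 x s)))) x = H (x, s) := by
    intro s hs x
    by_cases hx : x ∈ staySet hW k s
    · simp only [H]
      have hxS : (x, s) ∈ S := ⟨hs, hx⟩
      have hxs := hx s ⟨hs.1, le_rfl⟩
      rw [indicator_of_mem hx, indicator_of_mem hxS]
      simp only [y, projIcc_of_mem zero_le_one hs]
      rw [hWV k s hs _ (by linarith)]
    · simp only [H]
      have hxS : (x, s) ∉ S := fun h => hx h.2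
      rw [indicator_of_notMem hx, indicator_of_notMem hxS]
  have hstay : ∀ x, stayRelSpeed hW V k x = ∫⁻ s in Icc (0 : ℝ) 1, H (x, s) := fun x =>
    setLIntegral_congr_fun measurableSet_Icc fun s hs => hHeq s hs x
  refine ⟨?_, ?_⟩
  · rw [show stayRelSpeed hW V k = fun x => ∫⁻ s in Icc (0 : ℝ) 1, H (x, s) from funext hstay]
    exact hH.lintegral_prod_right'.aemeasurable
  · simp only [hstay]
    rw [lintegral_lintegral_swap (f := fun x s => H (x, s)) hH.aemeasurable]
    refine setLIntegral_mono' measurableSet_Icc fun s hs => ?_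
    have hm := (isClosed_staySet hW k hs).measurableSet
    have hF : Measurable fun z => ENNReal.ofReal (relSpeed z (V s z)) :=
      (measurable_relSpeed.comp (measurable_id.prodMk (hVc s hs).measurable)).ennreal_ofReal
    calc ∫⁻ x, H (x, s) ∂μ 0 = ∫⁻ x in staySet hW k s,
          ENNReal.ofReal (relSpeed ((hW k).flow 0 x s) (V s ((hW k).flow 0 x s))) ∂μ 0 := by
          rw [← lintegral_indicator hm]
          exact lintegral_congr fun x => (hHeq s hs x).symm
      _ = ∫⁻ z, ENNReal.ofReal (relSpeed z (V s z))
          ∂((μ 0).restrict (staySet hW k s)).map (fun x => (hW k).flow 0 x s) :=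
          (lintegral_map hF ((hW k).continuous_flow_right
            (Icc_zero_one_subset zero_mem_Icc) (Icc_zero_one_subset hs)).measurable).symm
      _ ≤ _ := lintegral_mono' (map_restrict_staySet_le hWV hμ hμp hV k hs) le_rfl

/-- Almost no trajectory explodes before time `1`. -/
theorem ae_exists_mem_staySet
    (hWV : ∀ k : ℕ, ∀ t ∈ Icc (0 : ℝ) 1, ∀ x, logSize x ≤ 2 * k → W k t x = V t x)
    (hVc : ∀ t ∈ Icc (0 : ℝ) 1, Continuous (V t)) (hμ : IsMeasureSolution μ V)
    (hμp : ∀ t ∈ Icc (0 : ℝ) 1, IsProbabilityMeasure (μ t)) (hV : totalRelSpeed μ V ≠ ⊤) :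
    ∀ᵐ x ∂μ 0, ∃ k : ℕ, x ∈ staySet hW k 1 := by
  have key : ∀ r : ℕ, ∀ᵐ x ∂μ 0, logSize x ≤ r → ∃ k : ℕ, x ∈ staySet hW k 1 := by
    intro r
    rw [ae_iff]
    set N := {x | ¬(logSize x ≤ r → ∃ k : ℕ, x ∈ staySet hW k 1)}
    have hN : ∀ j : ℕ, (j + 1 : ℕ) * μ 0 N ≤ totalRelSpeed μ V := by
      intro j
      -- leaving `logSize ≤ r + (j + 1)` from within `logSize ≤ r` takes relative speed `j + 1`
      obtain ⟨hm, hle⟩ := lintegral_stayRelSpeed_le (hW := hW) hWV hVc hμ hμp hV (r + (j + 1))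
      refine le_trans ?_ ((mul_meas_ge_le_lintegral₀ hm ((j + 1 : ℕ) : ℝ≥0∞)).trans hle)
      gcongr
      intro x hx
      simp only [N, mem_ofPred_eq, Classical.not_imp, not_exists] at hx
      have h1 := ofReal_sub_le_stayRelSpeed (hW := hW) hWV (k := r + (j + 1)) (r := r) hx.1 (hx.2 _)
      have e : ((r + (j + 1) : ℕ) : ℝ) - r = ((j + 1 : ℕ) : ℝ) := by push_cast; ring
      rwa [e, ENNReal.ofReal_natCast] at h1
    by_contra h
    obtain ⟨j, hj⟩ := ENNReal.exists_nat_mul_gt h hV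
    refine (hj.trans_le (le_trans ?_ (hN j))).false
    gcongr
    exact_mod_cast Nat.le_succ j
  filter_upwards [ae_all_iff.2 key] with x hx
  obtain ⟨r, hr⟩ := exists_nat_ge (logSize x)
  exact hx r hr

/-- A curve of probability measures that solves the continuity equation with finite total relative
speed is transported by the flow of its velocity field. -/
theorem exists_flow_map_eq
    (hW : ∀ k, IsTameField (W k) (K k) (M k))
    (hWV : ∀ k : ℕ, ∀ t ∈ Icc (0 : ℝ) 1, ∀ x, logSize x ≤ 2 * k → W k t x = V t x)
    (hVc : ∀ t ∈ Icc (0 : ℝ) 1, Continuous (V t)) (hμ : IsMeasureSolution μ V)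
    (hμp : ∀ t ∈ Icc (0 : ℝ) 1, IsProbabilityMeasure (μ t)) (hV : totalRelSpeed μ V ≠ ⊤) :
    ∃ X : ℝ → E → E, Measurable (fun p : E × ℝ => X p.2 p.1) ∧
      (∀ᵐ x ∂μ 0, X 0 x = x ∧ IsIntegralCurveOn (fun t => X t x) V (Icc 0 1)) ∧
      ∀ t ∈ Icc (0 : ℝ) 1, (μ 0).map (X t) = μ t := by
  classical
  have hp0 := hμp 0 zero_mem_Icc
  have h1I : (1 : ℝ) ∈ Icc (0 : ℝ) 1 := ⟨zero_le_one, le_rfl⟩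
  have hcl : ∀ k, MeasurableSet (staySet hW k 1) := fun k =>
    (isClosed_staySet hW k h1I).measurableSet
  -- the least `k` for which the trajectory stays in `logSize ≤ k` (and `0` if there is none)
  let p : E → ℕ → Prop := fun x k => x ∈ staySet hW k 1 ∨ x ∉ ⋃ j, staySet hW j 1
  have hp : ∀ x, ∃ k, p x k := fun x => by
    by_cases hx : x ∈ ⋃ j, staySet hW j 1
    · obtain ⟨k, hk⟩ := mem_iUnion.1 hx
      exact ⟨k, Or.inl hk⟩
    · exact ⟨0, Or.inr hx⟩
  let κ : E → ℕ := fun x => Nat.find (hp x)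
  have hκm : Measurable κ := measurable_find hp fun k =>
    (hcl k).union (MeasurableSet.iUnion hcl).compl
  have hκ : ∀ x k, x ∈ staySet hW k 1 → x ∈ staySet hW (κ x) 1 ∧ κ x ≤ k := fun x k hx =>
    ⟨(Nat.find_spec (hp x)).resolve_right (fun h => h (mem_iUnion.2 ⟨k, hx⟩)),
      Nat.find_min' (hp x) (Or.inl hx)⟩
  obtain ⟨X, hXm, hXI⟩ : ∃ X : ℝ → E → E, Measurable (fun p : E × ℝ => X p.2 p.1) ∧
      ∀ t ∈ Icc (0 : ℝ) 1, ∀ x, X t x = (hW (κ x)).flow 0 x t := by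
    refine ⟨fun t x => (hW (κ x)).flow 0 x (projIcc (0 : ℝ) 1 zero_le_one t), ?_,
      fun t ht x => by simp only [projIcc_of_mem zero_le_one ht]⟩
    have h1 : Measurable fun q : ℕ × (E × ℝ) =>
        (hW q.1).flow 0 q.2.1 (projIcc (0 : ℝ) 1 zero_le_one q.2.2) :=
      measurable_from_prod_countable_right fun k => (hW k).continuous_flow_projIcc.measurable
    exact h1.comp ((hκm.comp measurable_fst).prodMk measurable_id)
  have hae := ae_exists_mem_staySet (hW := hW) hWV hVc hμ hμp hV
  refine ⟨X, hXm, ?_, fun t ht => ?_⟩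
  · filter_upwards [hae] with x hx
    obtain ⟨k, hk⟩ := hx
    refine ⟨?_, fun t ht => ?_⟩
    · rw [hXI 0 zero_mem_Icc, (hW (κ x)).flow_self (Icc_zero_one_subset zero_mem_Icc)]
    · change HasDerivWithinAt (fun t => X t x) (V t (X t x)) (Icc 0 1) t
      rw [hXI t ht]
      exact (isIntegralCurveOn_of_mem_staySet hWV h1I (hκ x k hk).1 t ht).congr
        (fun s hs => hXI s hs x) (hXI t ht x)
  · have hpt := hμp t ht
    have hXt : Measurable (X t) := hXm.comp (measurable_prodMk_right (y := t))
    have hle : (μ 0).map (X t) ≤ μ t := by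
      refine Measure.le_iff.2 fun S hS => ?_
      rw [Measure.map_apply hXt hS]
      have h1 : μ 0 (X t ⁻¹' S) ≤ μ 0 (⋃ k, X t ⁻¹' S ∩ staySet hW k 1) := by
        refine measure_mono_ae ?_
        filter_upwards [hae] with x hx hxS
        obtain ⟨k, hk⟩ := hx
        exact mem_iUnion.2 ⟨k, hxS, hk⟩
      have hmono : Monotone fun k => X t ⁻¹' S ∩ staySet hW k 1 := fun i j hij =>
        inter_subset_inter_right _ (staySet_mono hWV hij h1I)
      rw [hmono.measure_iUnion] at h1
      refine h1.trans (iSup_le fun k => ?_)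
      have hfm : Measurable fun x => (hW k).flow 0 x t := ((hW k).continuous_flow_right
        (Icc_zero_one_subset zero_mem_Icc) (Icc_zero_one_subset ht)).measurable
      refine le_trans ?_ (map_restrict_staySet_le (hW := hW) hWV hμ hμp hV k ht S)
      rw [Measure.map_apply hfm hS, Measure.restrict_apply (hfm hS)]
      refine measure_mono fun x hx => ⟨?_, staySet_anti hW k ht.2 hx.2⟩
      obtain ⟨hκ1, hκ2⟩ := hκ x k hx.2
      have h2 : X t x ∈ S := hx.1
      rwa [hXI t ht, ← flow_eq_of_mem_staySet hWV hκ2 h1I hκ1 ht] at h2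
    have := Measure.isProbabilityMeasure_map (μ := μ 0) hXt.aemeasurable
    exact Measure.eq_of_le_of_measure_univ_eq hle (by rw [measure_univ, measure_univ])

end NonExplosion

/-! ### From fluid pairs to controlled processes -/

section Density

variable {n m : ℕ}

theorem isProbabilityMeasure_densityMeasure {ρ : Vec n → ℝ} (hρ : IsProbDensity ρ) :
    IsProbabilityMeasure (densityMeasure ρ) :=
  ⟨by rw [densityMeasure, withDensity_apply _ MeasurableSet.univ, Measure.restrict_univ,
    hρ.lintegral_eq_one]⟩

theorem integral_densityMeasure {ρ : Vec n → ℝ} (hρ : IsProbDensity ρ) (f : Vec n → ℝ) :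
    ∫ x, f x ∂densityMeasure ρ = ∫ x, f x * ρ x := by
  rw [densityMeasure, integral_withDensity_eq_integral_toReal_smul hρ.measurable.ennreal_ofReal
    (Eventually.of_forall fun x => ENNReal.ofReal_lt_top)]
  simp only [ENNReal.toReal_ofReal (hρ.nonneg _), smul_eq_mul, mul_comm]

theorem isWeakContinuitySolution_iff {ρ : ℝ → Vec n → ℝ}
    (hρ : ∀ t ∈ Icc (0 : ℝ) 1, IsProbDensity (ρ t)) (V : ℝ → Vec n → Vec n) :
    IsWeakContinuitySolution ρ V ↔ IsMeasureSolution (fun t => densityMeasure (ρ t)) V := by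
  refine forall_congr' fun φ => imp_congr_right fun _ => imp_congr_right fun _ =>
    forall₂_congr fun t ht => ?_
  have h1 : ∫ s in (0 : ℝ)..t, ∫ x, fderiv ℝ φ (s, x) (1, V s x) ∂densityMeasure (ρ s)
      = ∫ s in (0 : ℝ)..t, ∫ x, ρ s x * fderiv ℝ φ (s, x) (1, V s x) := by
    refine intervalIntegral.integral_congr fun s hs => ?_
    rw [uIcc_of_le ht.1] at hs
    simp only [integral_densityMeasure (hρ s ⟨hs.1, hs.2.trans ht.2⟩), mul_comm]
  simp only [integral_densityMeasure (hρ t ht), integral_densityMeasure (hρ 0 zero_mem_Icc), h1]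

theorem IsFeedbackLaw.continuous_projIcc {u : ℝ → Vec n → Vec m} (hu : IsFeedbackLaw u) :
    Continuous fun p : ℝ × Vec n => u (projIcc (0 : ℝ) 1 zero_le_one p.1) p.2 :=
  hu.continuousOn.comp_continuous
    (f := fun p : ℝ × Vec n => ((projIcc (0 : ℝ) 1 zero_le_one p.1 : ℝ), p.2))
    ((continuous_subtype_val.comp (_root_.continuous_projIcc.comp continuous_fst)).prodMk
      continuous_snd)
    fun p => ⟨(projIcc (0 : ℝ) 1 zero_le_one p.1).2, trivial⟩

/-- The energy of a feedback law as an integral over time of spatial averages. -/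
theorem lintegral_energy_density {u : ℝ → Vec n → Vec m} (hu : IsFeedbackLaw u)
    {ρ : ℝ → Vec n → ℝ} (hρm : Measurable fun p : ℝ × Vec n => ρ p.1 p.2)
    (hρ : ∀ t ∈ Icc (0 : ℝ) 1, IsProbDensity (ρ t)) :
    ∫⁻ x, ∫⁻ t in Icc (0 : ℝ) 1, ENNReal.ofReal (1 / 2 * ‖u t x‖ ^ 2 * ρ t x)
      = ∫⁻ t in Icc (0 : ℝ) 1, ∫⁻ x, ENNReal.ofReal (1 / 2 * ‖u t x‖ ^ 2)
          ∂densityMeasure (ρ t) := by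
  let c : Vec n → ℝ → ℝ := fun x t =>
    1 / 2 * ‖u (projIcc (0 : ℝ) 1 zero_le_one t) x‖ ^ 2
  have hc : ∀ t ∈ Icc (0 : ℝ) 1, ∀ x, 1 / 2 * ‖u t x‖ ^ 2 = c x t := fun t ht x => by
    simp only [c, projIcc_of_mem zero_le_one ht]
  have hcm : Measurable fun p : Vec n × ℝ => c p.1 p.2 := by
    have := (hu.continuous_projIcc.comp continuous_swap).measurable
    exact (this.norm.pow_const 2).const_mul _
  have hm : Measurable fun p : Vec n × ℝ => ENNReal.ofReal (c p.1 p.2 * ρ p.2 p.1) :=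
    (hcm.mul (hρm.comp measurable_swap)).ennreal_ofReal
  calc _ = ∫⁻ x, ∫⁻ t in Icc (0 : ℝ) 1, ENNReal.ofReal (c x t * ρ t x) :=
        lintegral_congr fun x => setLIntegral_congr_fun measurableSet_Icc fun t ht => by
          simp only [hc t ht x]
    _ = ∫⁻ t in Icc (0 : ℝ) 1, ∫⁻ x, ENNReal.ofReal (c x t * ρ t x) :=
        lintegral_lintegral_swap (f := fun x t => ENNReal.ofReal (c x t * ρ t x)) hm.aemeasurable
    _ = _ := by
        refine setLIntegral_congr_fun measurableSet_Icc fun t ht => ?_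
        have hct : Measurable fun x => ENNReal.ofReal (c x t) :=
          (hcm.comp (measurable_prodMk_right (y := t))).ennreal_ofReal
        simp only [hc t ht]
        rw [densityMeasure, lintegral_withDensity_eq_lintegral_mul _
          (hρ t ht).measurable.ennreal_ofReal hct]
        refine lintegral_congr fun x => ?_
        rw [Pi.mul_apply, ENNReal.ofReal_mul' ((hρ t ht).nonneg x), mul_comm]

/-- The expected energy spent along a process depends on its one-time marginals only. -/
theorem lintegral_energy_process {Ω : Type*} [MeasurableSpace Ω] (P : Measure Ω) [SFinite P]
    {u : ℝ → Vec n → Vec m} (hu : IsFeedbackLaw u) {X : ℝ → Ω → Vec n}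
    (hX : Measurable fun p : Ω × ℝ => X p.2 p.1) :
    ∫⁻ ω, (∫⁻ t in Icc (0 : ℝ) 1, ENNReal.ofReal (1 / 2 * ‖u t (X t ω)‖ ^ 2)) ∂P
      = ∫⁻ t in Icc (0 : ℝ) 1, ∫⁻ x, ENNReal.ofReal (1 / 2 * ‖u t x‖ ^ 2) ∂P.map (X t) := by
  let c : ℝ × Vec n → ℝ≥0∞ := fun p =>
    ENNReal.ofReal (1 / 2 * ‖u (projIcc (0 : ℝ) 1 zero_le_one p.1) p.2‖ ^ 2)
  have hc : ∀ t ∈ Icc (0 : ℝ) 1, ∀ x, ENNReal.ofReal (1 / 2 * ‖u t x‖ ^ 2) = c (t, x) :=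
    fun t ht x => by simp only [c, projIcc_of_mem zero_le_one ht]
  have hcm : Measurable c :=
    ((hu.continuous_projIcc.measurable.norm.pow_const 2).const_mul _).ennreal_ofReal
  have hm : Measurable fun p : Ω × ℝ => c (p.2, X p.2 p.1) :=
    hcm.comp (measurable_snd.prodMk hX)
  calc _ = ∫⁻ ω, (∫⁻ t in Icc (0 : ℝ) 1, c (t, X t ω)) ∂P :=
        lintegral_congr fun ω => setLIntegral_congr_fun measurableSet_Icc fun t ht => hc t ht _
    _ = ∫⁻ t in Icc (0 : ℝ) 1, ∫⁻ ω, c (t, X t ω) ∂P :=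
        lintegral_lintegral_swap (f := fun ω t => c (t, X t ω)) hm.aemeasurable
    _ = _ := by
        refine setLIntegral_congr_fun measurableSet_Icc fun t ht => ?_
        have hXt : Measurable (X t) := hX.comp (measurable_prodMk_right (y := t))
        have hct : Measurable fun x => c (t, x) := hcm.comp measurable_prodMk_left
        simp only [hc t ht]
        rw [lintegral_map hct hXt]

end Density

section FluidToStochastic

variable {n m : ℕ} {A : ℝ → Matrix (Fin n) (Fin n) ℝ} {B : ℝ → Matrix (Fin n) (Fin m) ℝ}

/-- Finite energy makes the total relative speed finite. -/
theorem totalRelSpeed_velocity_ne_top (hA : ContinuousOn A (Icc 0 1))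
    (hB : ContinuousOn B (Icc 0 1)) {u : ℝ → Vec n → Vec m} {μ : ℝ → Measure (Vec n)}
    (hμp : ∀ t ∈ Icc (0 : ℝ) 1, IsProbabilityMeasure (μ t))
    (hfin : ∫⁻ t in Icc (0 : ℝ) 1, ∫⁻ x, ENNReal.ofReal (1 / 2 * ‖u t x‖ ^ 2) ∂μ t ≠ ⊤) :
    totalRelSpeed μ (velocity A B u) ≠ ⊤ := by
  obtain ⟨C, hC⟩ := exists_relSpeed_velocity_le hA hB u
  have h1 : totalRelSpeed μ (velocity A B u) ≤ ∫⁻ t in Icc (0 : ℝ) 1,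
      C * (1 + ∫⁻ x, ENNReal.ofReal (1 / 2 * ‖u t x‖ ^ 2) ∂μ t) := by
    refine setLIntegral_mono' measurableSet_Icc fun t ht => ?_
    have := hμp t ht
    calc _ ≤ ∫⁻ x, C * (1 + ENNReal.ofReal (1 / 2 * ‖u t x‖ ^ 2)) ∂μ t := by
          refine lintegral_mono fun x => ?_
          refine (ENNReal.ofReal_le_ofReal (hC t ht x)).trans_eq ?_
          rw [ENNReal.ofReal_mul NNReal.zero_le_coe, ENNReal.ofReal_add zero_le_one (by positivity),
            ENNReal.ofReal_one, ENNReal.ofReal_coe_nnreal]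
      _ = _ := by
          rw [lintegral_const_mul' _ _ ENNReal.coe_ne_top, lintegral_add_left measurable_const]
          simp
  refine ne_top_of_le_ne_top ?_ h1
  rw [lintegral_const_mul' _ _ ENNReal.coe_ne_top, lintegral_add_left measurable_const]
  simp only [lintegral_const, Measure.restrict_apply_univ, Real.volume_Icc]
  finiteness

/-- The flow of a fluid pair of finite energy, started at `x₀`, is an admissible process with the
same energy. -/
theorem stochasticControlValue_le_of_isFluidPair (hA : ContinuousOn A (Icc 0 1))
    (hB : ContinuousOn B (Icc 0 1)) {ρ₀ ρ₁ : Vec n → ℝ} {Ω : Type*} [MeasurableSpace Ω]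
    (P : Measure Ω) [IsProbabilityMeasure P] {x₀ : Ω → Vec n}
    (hx₀ : HasLaw x₀ (densityMeasure ρ₀) P) {ρ : ℝ → Vec n → ℝ} {u : ℝ → Vec n → Vec m}
    (h : IsFluidPair A B ρ₀ ρ₁ ρ u) :
    stochasticControlValue A B P x₀ (densityMeasure ρ₁)
      ≤ ∫⁻ x, ∫⁻ t in Icc (0 : ℝ) 1, ENNReal.ofReal (1 / 2 * ‖u t x‖ ^ 2 * ρ t x) := by
  rw [lintegral_energy_density h.feedback h.measurable h.density]
  by_cases hfin : ∫⁻ t in Icc (0 : ℝ) 1, ∫⁻ x, ENNReal.ofReal (1 / 2 * ‖u t x‖ ^ 2)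
      ∂densityMeasure (ρ t) = ⊤
  · rw [hfin]; exact le_top
  set V := velocity A B u
  let μ : ℝ → Measure (Vec n) := fun t => densityMeasure (ρ t)
  have hμp : ∀ t ∈ Icc (0 : ℝ) 1, IsProbabilityMeasure (μ t) := fun t ht =>
    isProbabilityMeasure_densityMeasure (h.density t ht)
  have hμ : IsMeasureSolution μ V := (isWeakContinuitySolution_iff h.density V).1 h.continuity
  have hV : totalRelSpeed μ V ≠ ⊤ := totalRelSpeed_velocity_ne_top hA hB hμp hfin
  have hVc := continuousOn_velocity hA hB h.feedback
  have htrunc : ∀ k : ℕ, ∃ (W : ℝ → Vec n → Vec n) (K M : ℝ≥0), IsTameField W K M ∧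
      ∀ t ∈ Icc (0 : ℝ) 1, ∀ x, logSize x ≤ 2 * k → W t x = V t x := fun k => by
    obtain ⟨W, K, M, hW, hWV⟩ := exists_isTameField_eqOn hVc
      (locallyLipschitz_velocity hA hB h.feedback) (Real.exp_pos (2 * k)).le
    exact ⟨W, K, M, hW, fun t ht x hx => hWV t ht x (norm_le_of_logSize_le hx)⟩
  choose W K M hW hWV using htrunc
  have hVct : ∀ t ∈ Icc (0 : ℝ) 1, Continuous (V t) := fun t ht =>
    hVc.comp_continuous (Continuous.prodMk_right t) fun x => ⟨ht, trivial⟩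
  obtain ⟨X, hXm, hXc, hXμ⟩ := exists_flow_map_eq hW hWV hVct hμ hμp hV
  have hμ0 : μ 0 = densityMeasure ρ₀ := congrArg densityMeasure (funext h.initial)
  have hμ1 : μ 1 = densityMeasure ρ₁ := congrArg densityMeasure (funext h.final)
  -- a measurable version of the initial state
  set y₀ := hx₀.aemeasurable.mk x₀ with hy₀
  have hy₀m : Measurable y₀ := hx₀.aemeasurable.measurable_mk
  have hy₀x : x₀ =ᵐ[P] y₀ := hx₀.aemeasurable.ae_eq_mk
  have hy₀μ : P.map y₀ = μ 0 := by rw [hμ0, ← hx₀.map_eq, Measure.map_congr hy₀x]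
  have hXt : ∀ t, Measurable (X t) := fun t => hXm.comp (measurable_prodMk_right (y := t))
  have hXae : ∀ᵐ ω ∂P, X 0 (y₀ ω) = y₀ ω ∧
      IsIntegralCurveOn (fun t => X t (y₀ ω)) V (Icc 0 1) :=
    ae_of_ae_map hy₀m.aemeasurable (hy₀μ.symm ▸ hXc)
  have hlaw : ∀ t ∈ Icc (0 : ℝ) 1, P.map (fun ω => X t (y₀ ω)) = μ t := fun t ht => by
    rw [← hXμ t ht, ← hy₀μ, Measure.map_map (hXt t) hy₀m]
    rfl
  have hctrl : IsControlled A B P x₀ (densityMeasure ρ₁) u fun t ω => X t (y₀ ω) :=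
    { feedback := h.feedback
      measurable := fun t _ => (hXt t).comp hy₀m
      initial := by
        filter_upwards [hXae, hy₀x] with ω h1 h2
        rw [h1.1, h2]
      dynamics := by
        filter_upwards [hXae] with ω h1
        exact h1.2
      final := ⟨((hXt 1).comp hy₀m).aemeasurable, by
        rw [hlaw 1 ⟨zero_le_one, le_rfl⟩, hμ1]⟩ }
  have hval : stochasticControlValue A B P x₀ (densityMeasure ρ₁)
      ≤ ∫⁻ ω, (∫⁻ t in Icc (0 : ℝ) 1, ENNReal.ofReal (1 / 2 * ‖u t (X t (y₀ ω))‖ ^ 2)) ∂P :=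
    iInf_le_of_le u (iInf_le_of_le (fun t ω => X t (y₀ ω)) (iInf_le_of_le hctrl le_rfl))
  refine hval.trans_eq ?_
  have hjoint : Measurable fun p : Ω × ℝ => X p.2 (y₀ p.1) :=
    hXm.comp ((hy₀m.comp measurable_fst).prodMk measurable_snd)
  rw [lintegral_energy_process P h.feedback (X := fun t ω => X t (y₀ ω)) hjoint]
  exact setLIntegral_congr_fun measurableSet_Icc fun t ht => by simp only [hlaw t ht, μ]

end FluidToStochastic

/-! ### From controlled processes to fluid pairs -/

section ProcessLaw

variable {E : Type*} [NormedAddCommGroup E] [NormedSpace ℝ E] [FiniteDimensional ℝ E]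
  [MeasurableSpace E] [BorelSpace E]

/-- Lipschitz maps of a finite-dimensional space into itself preserve null sets. -/
theorem addHaar_image_eq_zero_of_lipschitzOnWith (ν : Measure E) [ν.IsAddHaarMeasure] {f : E → E}
    {C : ℝ≥0} {s : Set E} (hf : LipschitzOnWith C f s) (hs : ν s = 0) : ν (f '' s) = 0 := by
  have h1 : Measure.hausdorffMeasure (Module.finrank ℝ E : ℝ) s = 0 :=
    Measure.absolutelyContinuous_isAddHaarMeasure _ ν hs
  refine Measure.absolutelyContinuous_isAddHaarMeasure ν
    (Measure.hausdorffMeasure (Module.finrank ℝ E : ℝ)) ?_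
  refine le_antisymm ((hf.hausdorffMeasure_image_le (Nat.cast_nonneg _)).trans_eq ?_) bot_le
  rw [h1, mul_zero]

/-- The flow of a locally Lipschitz field pulls null sets back to null sets, because the inverse
flow is Lipschitz on the trajectories that stay in a ball. -/
theorem addHaar_setOf_integralCurve_mem_eq_zero (ν : Measure E) [ν.IsAddHaarMeasure]
    {V : ℝ → E → E}
    (hVL : ∀ R : ℝ, ∃ K : ℝ≥0, ∀ t ∈ Icc (0 : ℝ) 1, LipschitzOnWith K (V t) (closedBall 0 R))
    {t : ℝ} (ht : t ∈ Icc (0 : ℝ) 1) {N : Set E} (hN : ν N = 0) :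
    ν {a | ∃ y : ℝ → E, IsIntegralCurveOn y V (Icc 0 1) ∧ y 0 = a ∧ y t ∈ N} = 0 := by
  let Z : ℕ → Set E := fun R => {a | ∃ y : ℝ → E, IsIntegralCurveOn y V (Icc 0 1) ∧
    (∀ s ∈ Icc (0 : ℝ) 1, y s ∈ closedBall 0 (R : ℝ)) ∧ y 0 = a ∧ y t ∈ N}
  have hZ : ∀ R, ν (Z R) = 0 := by
    intro R
    obtain ⟨K, hK⟩ := hVL R
    let S : Set E := {b | b ∈ N ∧ ∃ y : ℝ → E, IsIntegralCurveOn y V (Icc 0 1) ∧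
      (∀ s ∈ Icc (0 : ℝ) 1, y s ∈ closedBall 0 (R : ℝ)) ∧ y t = b}
    have hS : ν S = 0 := measure_mono_null (fun b hb => hb.1) hN
    have hy : ∀ b : E, ∃ y : ℝ → E, b ∈ S → IsIntegralCurveOn y V (Icc 0 1) ∧
        (∀ s ∈ Icc (0 : ℝ) 1, y s ∈ closedBall 0 (R : ℝ)) ∧ y t = b := fun b => by
      by_cases hb : b ∈ S
      · obtain ⟨_, y, hy⟩ := hb
        exact ⟨y, fun _ => hy⟩
      · exact ⟨0, fun h => absurd h hb⟩
    choose y hy using hy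
    have hlip : LipschitzOnWith ⟨Real.exp (K * (1 - 0)), (Real.exp_pos _).le⟩
        (fun b => y b 0) S := LipschitzOnWith.of_dist_le_mul fun b hb b' hb' => by
      obtain ⟨h1, h2, h3⟩ := hy b hb
      obtain ⟨h1', h2', h3'⟩ := hy b' hb'
      have := IsIntegralCurveOn.dist_le hK h1 h2 h1' h2' ht zero_mem_Icc
      rwa [h3, h3'] at this
    refine measure_mono_null ?_ (addHaar_image_eq_zero_of_lipschitzOnWith ν hlip hS)
    rintro a ⟨z, hz1, hz2, hz3, hz4⟩
    have hb : z t ∈ S := ⟨hz4, z, hz1, hz2, rfl⟩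
    obtain ⟨h1, h2, h3⟩ := hy (z t) hb
    refine ⟨z t, hb, ?_⟩
    have := IsIntegralCurveOn.dist_le hK h1 h2 hz1 hz2 ht zero_mem_Icc
    rw [h3, dist_self, mul_zero] at this
    exact (dist_le_zero.1 this).trans hz3
  refine measure_mono_null ?_ (measure_iUnion_null hZ)
  rintro a ⟨y, hy, h0, hN⟩
  obtain ⟨C, hC⟩ := isCompact_Icc.exists_bound_of_continuousOn hy.continuousOn
  obtain ⟨R, hR⟩ := exists_nat_ge C
  exact mem_iUnion.2 ⟨R, y, hy, fun s hs => by simpa using (hC s hs).trans hR, h0, hN⟩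

/-- The marginals of a process that follows the integral curves of `V` solve the continuity
equation. -/
theorem isMeasureSolution_map {E : Type*} [NormedAddCommGroup E] [InnerProductSpace ℝ E]
    [FiniteDimensional ℝ E] [MeasurableSpace E] [BorelSpace E]
    {Ω : Type*} [MeasurableSpace Ω] (P : Measure Ω) [IsProbabilityMeasure P]
    {V : ℝ → E → E}
    (hVc : ContinuousOn (fun p : ℝ × E => V p.1 p.2) (Icc (0 : ℝ) 1 ×ˢ univ))
    {X : ℝ → Ω → E} (hX : Measurable fun p : ℝ × Ω => X p.1 p.2)
    (hXV : ∀ᵐ ω ∂P, IsIntegralCurveOn (fun t => X t ω) V (Icc 0 1)) :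
    IsMeasureSolution (fun t => P.map (X t)) V := by
  intro φ hφs hφc t ht
  have hXt : ∀ s, Measurable (X s) := fun s => hX.comp measurable_prodMk_left
  let V' : ℝ × E → E := fun p => V (projIcc (0 : ℝ) 1 zero_le_one p.1) p.2
  have hV'c : Continuous V' := hVc.comp_continuous
    (f := fun p : ℝ × E => ((projIcc (0 : ℝ) 1 zero_le_one p.1 : ℝ), p.2))
    ((continuous_subtype_val.comp (continuous_projIcc.comp continuous_fst)).prodMk continuous_snd)
    fun p => ⟨(projIcc (0 : ℝ) 1 zero_le_one p.1).2, trivial⟩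
  have hV' : ∀ s ∈ Icc (0 : ℝ) 1, ∀ x, V' (s, x) = V s x := fun s hs x => by
    simp only [V', projIcc_of_mem zero_le_one hs]
  -- the derivative of `φ` along the flow is continuous with compact support
  let D : ℝ × E → ℝ := fun p => fderiv ℝ φ p (1, V' p)
  have hDc : Continuous D :=
    (hφs.continuous_fderiv (by simp)).clm_apply (continuous_const.prodMk hV'c)
  have hDs : HasCompactSupport D := by
    refine HasCompactSupport.intro (hφc.fderiv (𝕜 := ℝ)).isCompact fun p hp => ?_
    have : fderiv ℝ φ p = 0 := image_eq_zero_of_notMem_tsupport hp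
    simp [D, this]
  obtain ⟨C, hC⟩ := hDs.exists_bound_of_continuous hDc
  obtain ⟨C', hC'⟩ := hφc.exists_bound_of_continuous hφs.continuous
  have hint : ∀ s, Integrable (fun ω => φ (s, X s ω)) P := fun s =>
    Integrable.of_bound ((hφs.continuous.measurable.comp
      (measurable_const.prodMk (hXt s))).aestronglyMeasurable) C'
      (Eventually.of_forall fun ω => hC' _)
  have hDX : Measurable fun p : ℝ × Ω => D (p.1, X p.1 p.2) :=
    hDc.measurable.comp (measurable_fst.prodMk hX)
  have hpath : ∀ᵐ ω ∂P, φ (t, X t ω) - φ (0, X 0 ω) = ∫ s in (0 : ℝ)..t, D (s, X s ω) := by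
    filter_upwards [hXV] with ω hω
    have hsub : Icc 0 t ⊆ Icc (0 : ℝ) 1 := Icc_subset_Icc_right ht.2
    have hc : ContinuousOn (fun s => (s, X s ω)) (Icc 0 t) :=
      continuousOn_id.prodMk (hω.continuousOn.mono hsub)
    refine (intervalIntegral.integral_eq_sub_of_hasDerivAt_of_le ht.1
      (hφs.continuous.comp_continuousOn hc) (fun s hs => ?_)
      ((hDc.comp_continuousOn hc).intervalIntegrable_of_Icc ht.1)).symm
    have hsI := hsub (Ioo_subset_Icc_self hs)
    have h1 : HasDerivAt (fun s => X s ω) (V s (X s ω)) s :=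
      (hω s hsI).hasDerivAt (Icc_mem_nhds hs.1 (hs.2.trans_le ht.2))
    have h2 : HasDerivAt (fun s => (s, X s ω)) ((1 : ℝ), V s (X s ω)) s :=
      (hasDerivAt_id s).prodMk h1
    have h3 := (hφs.differentiable (by simp) (s, X s ω)).hasFDerivAt.comp_hasDerivAt s h2
    rw [← hV' s hsI] at h3
    exact h3
  have hprod : Integrable (Function.uncurry fun (s : ℝ) (ω : Ω) => D (s, X s ω))
      ((volume.restrict (Ioc 0 t)).prod P) :=
    Integrable.of_bound hDX.aestronglyMeasurable C (Eventually.of_forall fun p => hC _)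
  have e1 : ∀ s, ∫ x, φ (s, x) ∂P.map (X s) = ∫ ω, φ (s, X s ω) ∂P := fun s =>
    integral_map (hXt s).aemeasurable (f := fun x => φ (s, x))
      (hφs.continuous.comp (Continuous.prodMk_right s)).aestronglyMeasurable
  have e2 : ∀ s, ∫ x, D (s, x) ∂P.map (X s) = ∫ ω, D (s, X s ω) ∂P := fun s =>
    integral_map (hXt s).aemeasurable (f := fun x => D (s, x))
      (hDc.comp (Continuous.prodMk_right s)).aestronglyMeasurable
  calc (∫ x, φ (t, x) ∂P.map (X t)) - ∫ x, φ (0, x) ∂P.map (X 0)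
      = ∫ ω, (φ (t, X t ω) - φ (0, X 0 ω)) ∂P := by
        rw [e1, e1, integral_sub (hint t) (hint 0)]
    _ = ∫ ω, (∫ s in Ioc 0 t, D (s, X s ω)) ∂P := by
        refine integral_congr_ae ?_
        filter_upwards [hpath] with ω hω
        rw [hω, intervalIntegral.integral_of_le ht.1]
    _ = ∫ s in Ioc 0 t, ∫ ω, D (s, X s ω) ∂P :=
        (integral_integral_swap hprod).symm
    _ = ∫ s in (0 : ℝ)..t, ∫ x, fderiv ℝ φ (s, x) (1, V s x) ∂P.map (X s) := by
        rw [intervalIntegral.integral_of_le ht.1]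
        refine setIntegral_congr_fun measurableSet_Ioc fun s hs => ?_
        have hsI : s ∈ Icc (0 : ℝ) 1 := ⟨hs.1.le, hs.2.trans ht.2⟩
        rw [← e2]
        simp only [D, hV' s hsI]

/-- The marginals of a jointly measurable process have a jointly measurable density, wherever they
are absolutely continuous. -/
theorem exists_measurable_density {n : ℕ} {Ω : Type*} [MeasurableSpace Ω] (P : Measure Ω)
    [IsProbabilityMeasure P] {X : ℝ → Ω → Vec n} (hX : Measurable fun p : ℝ × Ω => X p.1 p.2)
    {T : Set ℝ} (hT : ∀ t ∈ T, P.map (X t) ≪ volume) :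
    ∃ ρ : ℝ → Vec n → ℝ, Measurable (fun p : ℝ × Vec n => ρ p.1 p.2) ∧ (∀ t x, 0 ≤ ρ t x) ∧
      ∀ t ∈ T, densityMeasure (ρ t) = P.map (X t) := by
  have hXt : ∀ s, Measurable (X s) := fun s => hX.comp measurable_prodMk_left
  let κ : Kernel ℝ (Vec n) := ⟨fun t => P.map (X t), by
    refine Measure.measurable_of_measurable_coe _ fun S hS => ?_
    have := measurable_measure_prodMk_left (ν := P) (hX hS)
    convert this using 2 with t
    rw [Measure.map_apply (hXt t) hS]
    rfl⟩
  have hκ : ∀ t, κ t = P.map (X t) := fun t => rfl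
  have : IsMarkovKernel κ := ⟨fun t => Measure.isProbabilityMeasure_map (hXt t).aemeasurable⟩
  -- kernel densities are taken with respect to a finite measure equivalent to Lebesgue measure
  let ν : Measure (Vec n) := (volume : Measure (Vec n)).toFinite
  have hν1 : (volume : Measure (Vec n)) ≪ ν := absolutelyContinuous_toFinite volume
  have hν2 : ν ≪ volume := toFinite_absolutelyContinuous volume
  let η : Kernel ℝ (Vec n) := Kernel.const ℝ ν
  let f : ℝ → Vec n → ℝ≥0∞ := fun t x => ν.rnDeriv volume x * κ.rnDeriv η t x
  have hf : Measurable fun p : ℝ × Vec n => f p.1 p.2 :=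
    ((Measure.measurable_rnDeriv ν volume).comp measurable_snd).mul
      (Kernel.measurable_rnDeriv κ η)
  have hft : ∀ t, Measurable (f t) := fun t => hf.comp measurable_prodMk_left
  have hfκ : ∀ t ∈ T, volume.withDensity (f t) = κ t := fun t ht => by
    have h1 : η.withDensity (κ.rnDeriv η) t = κ t :=
      Kernel.withDensity_rnDeriv_eq ((hT t ht).trans hν1)
    rw [Kernel.withDensity_apply _ (Kernel.measurable_rnDeriv κ η), Kernel.const_apply] at h1
    have h2 : f t = ν.rnDeriv volume * κ.rnDeriv η t := rfl
    rw [h2, withDensity_mul _ (Measure.measurable_rnDeriv ν volume)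
      (Kernel.measurable_rnDeriv_right κ η t), Measure.withDensity_rnDeriv_eq ν volume hν2, h1]
  refine ⟨fun t x => (f t x).toReal, hf.ennreal_toReal, fun t x => ENNReal.toReal_nonneg,
    fun t ht => ?_⟩
  rw [← hκ, ← hfκ t ht, densityMeasure]
  have hlt : ∀ᵐ x, f t x < ⊤ := by
    refine ae_lt_top (hft t) ?_
    have : ∫⁻ x, f t x = κ t univ := by
      rw [← hfκ t ht, withDensity_apply _ MeasurableSet.univ, Measure.restrict_univ]
    rw [this]
    exact measure_ne_top _ _
  refine withDensity_congr_ae ?_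
  filter_upwards [hlt] with x hx
  exact ENNReal.ofReal_toReal hx.ne

end ProcessLaw

section StochasticToFluid

variable {n m : ℕ} {A : ℝ → Matrix (Fin n) (Fin n) ℝ} {B : ℝ → Matrix (Fin n) (Fin m) ℝ}

/-- A version of a controlled process that is continuous in time everywhere, hence jointly
measurable. -/
theorem IsControlled.exists_measurable_version {Ω : Type*} [MeasurableSpace Ω] {P : Measure Ω}
    {x₀ : Ω → Vec n} {μ₁ : Measure (Vec n)} {u : ℝ → Vec n → Vec m} {x : ℝ → Ω → Vec n}
    (h : IsControlled A B P x₀ μ₁ u x) :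
    ∃ X : ℝ → Ω → Vec n, Measurable (fun p : ℝ × Ω => X p.1 p.2) ∧
      ∀ᵐ ω ∂P, (∀ t ∈ Icc (0 : ℝ) 1, X t ω = x t ω) ∧ X 0 ω = x₀ ω ∧
        IsIntegralCurveOn (fun t => X t ω) (velocity A B u) (Icc 0 1) := by
  classical
  obtain ⟨G, hGae, hGm, hGsub⟩ := (h.initial.and h.dynamics).exists_measurable_mem
  let X : ℝ → Ω → Vec n := fun t => G.indicator (x (projIcc (0 : ℝ) 1 zero_le_one t))
  have hXx : ∀ ω ∈ G, ∀ t ∈ Icc (0 : ℝ) 1, X t ω = x t ω := fun ω hω t ht => by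
    simp only [X, indicator_of_mem hω, projIcc_of_mem zero_le_one ht]
  refine ⟨X, measurable_uncurry_of_continuous_of_measurable (fun ω => ?_) fun t =>
    (h.measurable _ (projIcc (0 : ℝ) 1 zero_le_one t).2).indicator hGm, ?_⟩
  · by_cases hω : ω ∈ G
    · simp only [indicator_of_mem hω]
      have hc : ContinuousOn (fun s => x s ω) (Icc 0 1) := fun t ht =>
        ((hGsub ω hω).2 t ht).continuousWithinAt
      exact hc.comp_continuous (continuous_subtype_val.comp continuous_projIcc)
        fun t => (projIcc (0 : ℝ) 1 zero_le_one t).2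
    · simp only [indicator_of_notMem hω]
      exact continuous_const
  · filter_upwards [hGae] with ω hω
    refine ⟨hXx ω hω, (hXx ω hω 0 zero_mem_Icc).trans (hGsub ω hω).1, fun t ht => ?_⟩
    change HasDerivWithinAt (fun t => X t ω) (velocity A B u t (X t ω)) (Icc 0 1) t
    rw [hXx ω hω t ht]
    exact ((hGsub ω hω).2 t ht).congr (hXx ω hω) (hXx ω hω t ht)

/-- The densities of the marginals of a controlled process form, with its feedback law, a fluid pair
of the same energy. -/
theorem fluidValue_le_of_isControlled (hA : ContinuousOn A (Icc 0 1))
    (hB : ContinuousOn B (Icc 0 1)) {ρ₀ ρ₁ : Vec n → ℝ} (hρ₀ : IsProbDensity ρ₀)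
    (hρ₁ : IsProbDensity ρ₁) {Ω : Type*} [MeasurableSpace Ω]
    (P : Measure Ω) [IsProbabilityMeasure P] {x₀ : Ω → Vec n}
    (hx₀ : HasLaw x₀ (densityMeasure ρ₀) P) {u : ℝ → Vec n → Vec m} {x : ℝ → Ω → Vec n}
    (h : IsControlled A B P x₀ (densityMeasure ρ₁) u x) :
    fluidValue A B ρ₀ ρ₁
      ≤ ∫⁻ ω, (∫⁻ t in Icc (0 : ℝ) 1, ENNReal.ofReal (1 / 2 * ‖u t (x t ω)‖ ^ 2)) ∂P := by
  classical
  obtain ⟨X, hXm, hXae⟩ := h.exists_measurable_version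
  have hXt : ∀ t, Measurable (X t) := fun t => hXm.comp measurable_prodMk_left
  have h1I : (1 : ℝ) ∈ Icc (0 : ℝ) 1 := ⟨zero_le_one, le_rfl⟩
  have hVL := locallyLipschitz_velocity hA hB h.feedback
  have hac : ∀ t ∈ Icc (0 : ℝ) 1, P.map (X t) ≪ volume := fun t ht => by
    refine Measure.AbsolutelyContinuous.mk fun N hN hN0 => ?_
    rw [Measure.map_apply (hXt t) hN]
    set Z := {a | ∃ y : ℝ → Vec n, IsIntegralCurveOn y (velocity A B u) (Icc 0 1) ∧
      y 0 = a ∧ y t ∈ N}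
    have hZ : volume Z = 0 := addHaar_setOf_integralCurve_mem_eq_zero volume hVL ht hN0
    have hZ0 : P.map x₀ Z = 0 := by
      rw [hx₀.map_eq]
      exact withDensity_absolutelyContinuous _ _ hZ
    refine measure_mono_null_ae ?_ (Measure.preimage_null_of_map_null hx₀.aemeasurable hZ0)
    filter_upwards [hXae] with ω hω hωN
    exact ⟨fun t => X t ω, hω.2.2, hω.2.1, hωN⟩
  obtain ⟨ρ', hρ'm, hρ'0, hρ'⟩ := exists_measurable_density P hXm hac
  have hlaw0 : P.map (X 0) = densityMeasure ρ₀ := by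
    rw [← hx₀.map_eq]
    exact Measure.map_congr (by filter_upwards [hXae] with ω hω using hω.2.1)
  have hlaw1 : P.map (X 1) = densityMeasure ρ₁ := by
    rw [← h.final.map_eq]
    exact Measure.map_congr (by filter_upwards [hXae] with ω hω using hω.1 1 h1I)
  -- the end-point conditions are pointwise, so the densities are redefined at times `0` and `1`
  let ρ : ℝ → Vec n → ℝ := fun t x => if t = 0 then ρ₀ x else if t = 1 then ρ₁ x else ρ' t x
  have hρm : Measurable fun p : ℝ × Vec n => ρ p.1 p.2 :=
    Measurable.ite (measurable_fst (measurableSet_singleton 0))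
      (hρ₀.measurable.comp measurable_snd)
      (Measurable.ite (measurable_fst (measurableSet_singleton 1))
        (hρ₁.measurable.comp measurable_snd) hρ'm)
  have hρ0 : ρ 0 = ρ₀ := by ext x; simp [ρ]
  have hρ1 : ρ 1 = ρ₁ := by ext x; simp [ρ]
  have hρμ : ∀ t ∈ Icc (0 : ℝ) 1, densityMeasure (ρ t) = P.map (X t) := fun t ht => by
    by_cases h0 : t = 0
    · rw [h0, hρ0, hlaw0]
    by_cases h1 : t = 1
    · rw [h1, hρ1, hlaw1]
    have : ρ t = ρ' t := by ext x; simp [ρ, h0, h1]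
    rw [this, hρ' t ht]
  have hρd : ∀ t ∈ Icc (0 : ℝ) 1, IsProbDensity (ρ t) := fun t ht =>
    { measurable := hρm.comp measurable_prodMk_left
      nonneg := fun x => by
        simp only [ρ]
        split_ifs
        · exact hρ₀.nonneg x
        · exact hρ₁.nonneg x
        · exact hρ'0 t x
      lintegral_eq_one := by
        have h1 := congrArg (fun μ : Measure (Vec n) => μ univ) (hρμ t ht)
        have := Measure.isProbabilityMeasure_map (μ := P) (hXt t).aemeasurable
        simpa [densityMeasure, withDensity_apply _ MeasurableSet.univ] using h1 }
  have hsol : IsMeasureSolution (fun t => P.map (X t)) (velocity A B u) :=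
    isMeasureSolution_map P (continuousOn_velocity hA hB h.feedback) hXm
      (by filter_upwards [hXae] with ω hω using hω.2.2)
  have hpair : IsFluidPair A B ρ₀ ρ₁ ρ u :=
    { feedback := h.feedback
      measurable := hρm
      density := hρd
      continuity := by
        rw [isWeakContinuitySolution_iff hρd]
        intro φ hφs hφc t ht
        have := hsol φ hφs hφc t ht
        simp only [hρμ t ht, hρμ 0 zero_mem_Icc]
        refine this.trans (intervalIntegral.integral_congr fun s hs => ?_)
        rw [uIcc_of_le ht.1] at hs
        simp only [hρμ s ⟨hs.1, hs.2.trans ht.2⟩]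
      initial := fun x => congrFun hρ0 x
      final := fun x => congrFun hρ1 x }
  have hval : fluidValue A B ρ₀ ρ₁
      ≤ ∫⁻ x, ∫⁻ t in Icc (0 : ℝ) 1, ENNReal.ofReal (1 / 2 * ‖u t x‖ ^ 2 * ρ t x) :=
    iInf_le_of_le ρ (iInf_le_of_le u (iInf_le_of_le hpair le_rfl))
  refine hval.trans_eq ?_
  rw [lintegral_energy_density h.feedback hρm hρd]
  have hcost : ∫⁻ ω, (∫⁻ t in Icc (0 : ℝ) 1, ENNReal.ofReal (1 / 2 * ‖u t (x t ω)‖ ^ 2)) ∂P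
      = ∫⁻ ω, (∫⁻ t in Icc (0 : ℝ) 1, ENNReal.ofReal (1 / 2 * ‖u t (X t ω)‖ ^ 2)) ∂P := by
    refine lintegral_congr_ae ?_
    filter_upwards [hXae] with ω hω
    exact setLIntegral_congr_fun measurableSet_Icc fun t ht => by simp only [hω.1 t ht]
  rw [hcost, lintegral_energy_process P h.feedback (hXm.comp measurable_swap)]
  exact setLIntegral_congr_fun measurableSet_Icc fun t ht => by simp only [hρμ t ht]

end StochasticToFluid

end LinearControl

end

theorem mainTheorem2 {n m : ℕ}
    (A : ℝ → Matrix (Fin n) (Fin n) ℝ) (B : ℝ → Matrix (Fin n) (Fin m) ℝ)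
    (hA : ContinuousOn A (Set.Icc 0 1)) (hB : ContinuousOn B (Set.Icc 0 1))
    (ρ₀ ρ₁ : LinearControl.Vec n → ℝ)
    (hρ₀ : LinearControl.IsProbDensity ρ₀) (hρ₁ : LinearControl.IsProbDensity ρ₁)
    {Ω : Type*} [MeasurableSpace Ω] (P : MeasureTheory.Measure Ω)
    [MeasureTheory.IsProbabilityMeasure P] (x₀ : Ω → LinearControl.Vec n)
    (hx₀ : ProbabilityTheory.HasLaw x₀ (LinearControl.densityMeasure ρ₀) P) :
    LinearControl.stochasticControlValue A B P x₀ (LinearControl.densityMeasure ρ₁)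
      = LinearControl.fluidValue A B ρ₀ ρ₁ := by
  refine le_antisymm ?_ ?_
  · exact le_iInf fun ρ => le_iInf fun u => le_iInf fun h =>
      LinearControl.stochasticControlValue_le_of_isFluidPair hA hB P hx₀ h
  · exact le_iInf fun u => le_iInf fun x => le_iInf fun h =>
      LinearControl.fluidValue_le_of_isControlled hA hB hρ₀ hρ₁ P hx₀ h
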